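/- Let $\mathbb D$ be the open unit disc and $\mathrm{Hol}(\mathbb D)$ the space of holomorphic functions on it. Let $H^\infty$ be the space of bounded $f\in\mathrm{Hol}(\mathbb D)$ with $\|f\|_\infty=\sup_{\mathbb D}|f|$. For $\alpha\le 0$ let $l_a^2(\alpha)$ be the space of $f=\sum_{k\ge0}\hat f(k)z^k\in\mathrm{Hol}(\mathbb D)$ with $\|f\|^2=\sum_{k\ge0}|\hat f(k)|^2(k+1)^{2\alpha}<\infty$. For $\beta>-1$ let $L_a^2(\beta)$ be the space of $f\in\mathrm{Hol}(\mathbb D)$ with $\|f\|^2=\int_{\mathbb D}|f(z)|^2(1-|z|^2)^\beta\,dA(z)<\infty$, where $dA=\pi^{-1}dx\,dy$. For a finite multiset $\sigma\subset\mathbb D$ and a space $X$ put $$c(\sigma,X,H^\infty)=\sup_{f\in X,\ \|f\|_X\le1}\ \inf\{\|g\|_\infty:\ g\in H^\infty,\ g|_\sigma=f|_\sigma\},$$ where $g|_\sigma=f|_\sigma$ means that $g^{(k)}(\mu)=f^{(k)}(\mu)$ for every $\mu\in\sigma$ and every $0\le k<m$, with $m$ the multiplicity of $\mu$ in $\sigma$.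 Put $C_{n,r}(X,H^\infty)=\sup c(\sigma,X,H^\infty)$, the supremum being over all $\sigma$ with at most $n$ points (counted with multiplicity), all of modulus at most $r$. Let $\sigma_{n,\lambda}$ be the multiset consisting of $\lambda$ with multiplicity $n$. Theorem B. (i) For every $\alpha\le0$ there are constants $A,B>0$ depending only on $\alpha$ such that, for all integers $n\ge1$, all $r\in[0,1)$ and all $\lambda\in\mathbb C$ with $|\lambda|\le r$, $$B\Big(\frac n{1-|\lambda|}\Big)^{\frac{1-2\alpha}2}\le c(\sigma_{n,\lambda},l_a^2(\alpha),H^\infty)\le C_{n,r}(l_a^2(\alpha),H^\infty)\le A\Big(\frac n{1-r}\Big)^{\frac{1-2\alpha}2},$$ where the left-hand inequality is asserted only when $1-2\alpha$ is a positive integer. (ii) For every $\beta>-1$ there are constants $A',B'>0$ depending only on $\beta$ such that, for all integers $n\ge1$, all $r\in[0,1)$ and all $\lambda\in\mathbb C$ with $|\lambda|\le r$, $$B'\Big(\frac n{1-|\lambda|}\Big)^{\frac{\beta+2}2}\le c(\sigma_{n,\lambda},L_a^2(\beta),H^\infty)\le C_{n,r}(L_a^2(\beta),H^\infty)\le A'\Big(\frac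 n{1-r}\Big)^{\frac{\beta+2}2},$$ where the left-hand inequality is asserted only when $\beta+2$ is a positive integer. -/

import Mathlib

open scoped ENNReal

noncomputable section

namespace DiscInterp

/-- `Hol(𝔻)`: the functions that are holomorphic in the open unit disc. Values outside the
disc play no role anywhere below. -/
def Hol : Set (ℂ → ℂ) := {f | DifferentiableOn ℂ f (Metric.ball (0 : ℂ) 1)}

/-- The `k`-th Taylor coefficient of `f` at the origin. -/
def taylorCoeff (f : ℂ → ℂ) (k : ℕ) : ℂ := iteratedDeriv k f 0 / (k.factorial : ℂ)

/-- The norm of `H^∞`, with value `∞` on unbounded functions. -/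
def normHInf (f : ℂ → ℂ) : ℝ≥0∞ := ⨆ z ∈ Metric.ball (0 : ℂ) 1, ‖f z‖ₑ

/-- The norm of `l_a^2(α)`: `‖f‖² = ∑ |f̂(k)|² (k+1)^{2α}`, with value `∞` when the series
diverges. -/
def normLa2 (α : ℝ) (f : ℂ → ℂ) : ℝ≥0∞ :=
  (∑' k : ℕ, ‖taylorCoeff f k‖ₑ ^ 2 * ENNReal.ofReal (((k : ℝ) + 1) ^ (2 * α))) ^ (1 / 2 : ℝ)

/-- The norm of the weighted Bergman space `L_a^2(β)`: `‖f‖² = ∫_𝔻 |f|² (1 - |z|²)^β dA` with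
`dA` the area measure of the plane divided by `π`; the value is `∞` when the integral diverges. -/
def normBergman (β : ℝ) (f : ℂ → ℂ) : ℝ≥0∞ :=
  (ENNReal.ofReal (Real.pi⁻¹) * ∫⁻ z in Metric.ball (0 : ℂ) 1,
    ‖f z‖ₑ ^ 2 * ENNReal.ofReal ((1 - ‖z‖ ^ 2) ^ β)) ^ (1 / 2 : ℝ)

/-- The Banach space of holomorphic functions in the disc given by an extended norm. -/
def space (N : (ℂ → ℂ) → ℝ≥0∞) : Set (ℂ → ℂ) := {f | f ∈ Hol ∧ N f < ∞}

/-- `g` and `f` have the same trace on `σ`, where a point of multiplicity `m` in `σ` prescribes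
the derivatives of order `0, …, m - 1`. -/
def SameTrace (σ : Multiset ℂ) (g f : ℂ → ℂ) : Prop :=
  ∀ z ∈ σ, ∀ k < σ.count z, iteratedDeriv k g z = iteratedDeriv k f z

/-- `c(σ, X, Y) = sup_{f ∈ X, ‖f‖_X ≤ 1} inf {‖g‖_Y : g ∈ Y, g|σ = f|σ}`, where `X` and `Y` are
the spaces with norms `NX` and `NY`. -/
def interpConst (σ : Multiset ℂ) (NX NY : (ℂ → ℂ) → ℝ≥0∞) : ℝ≥0∞ :=
  ⨆ f ∈ {f : ℂ → ℂ | f ∈ space NX ∧ NX f ≤ 1},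
    ⨅ g ∈ {g : ℂ → ℂ | g ∈ space NY ∧ SameTrace σ g f}, NY g

/-- `C_{n,r}(X, Y) = sup {c(σ, X, Y) : card σ ≤ n, |z| ≤ r for all z ∈ σ}`, points of `σ` being
counted with multiplicity. -/
def maxInterpConst (n : ℕ) (r : ℝ) (NX NY : (ℂ → ℂ) → ℝ≥0∞) : ℝ≥0∞ :=
  ⨆ σ ∈ {σ : Multiset ℂ | σ.card ≤ n ∧ ∀ z ∈ σ, ‖z‖ ≤ r}, interpConst σ NX NY

/-- `σ_{n,lam}`: the point `lam` with multiplicity `n`. -/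
def onePoint (n : ℕ) (lam : ℂ) : Multiset ℂ := Multiset.replicate n lam

end DiscInterp

end

/-!
The upper bounds come from an explicit linear interpolation operator. Let `B` be the Blaschke
product of the points `σ` and `B♯(w) = conj (B (conj w))`. The kernel `K(z, w) = (1 - B(z) B♯(w))
/ (1 - z w)` has Taylor coefficients `g_k(z)` in `w` that interpolate `z ^ k` on `σ`
(`exists_taylorCoeff_modelKernel`), so `g = ∑ f̂(k) g_k` interpolates `f = ∑ f̂(k) z ^ k`. With `t
= (1 - r) / (4 n)`, each Blaschke factor is at most `1 + O(1 / n)` in modulus on the circle `|w| =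
1 + t`, hence `B♯` is bounded there by an absolute constant, and for `|z| = 1` the mean square of
`K(z, ·)` on this circle is `O(1 / t)`, by the Poisson integral of `1`
(`circleAverage_normSq_modelKernel_le`). By Parseval's identity `∑ |g_k(z)|² (1 + t) ^ (2 k)` is
`O(1 / t)`; since `(k + 1) ^ (-2 α)` is `O(t ^ (2 α) (1 + t) ^ (2 k))`, the Cauchy-Schwarz
inequality gives `|g(z)|² = O(t ^ (2 α - 1) ‖f‖²)` on the unit circle, and the maximum principle
concludes (`exists_interpolant`). No interpolation between spaces is needed for non-integral
exponents.

For the lower bounds let `N = 1 - 2 α`. The functions `b ^ k / (1 - conj lam z)`, with `b` a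
rotated Blaschke factor of `lam`, are orthogonal in `H²`; let `h` be the sum of the first `p` of them,
where `p` is about `n / (N + 1)`, and let `f` be a multiple of `h ^ N`. The norm of `h ^ N` in
`l_a^2((1 - N) / 2)` is at most `‖h‖ ^ N`, by the Cauchy-Schwarz inequality for convolutions
(`normLa2_const_mul_pow_le`). A suitable disc automorphism `φ` that takes `0` to `lam` turns `f`
into a polynomial `f ∘ φ` with nonnegative coefficients, and for any interpolant `g` the
coefficients of `g ∘ φ` of order less than `n` are the same. Let `D` be the geometric sum of
length `p`. A Fejér type inequality (`norm_sum_taylorCoeff_mul_geomPoly_le`) bounds the sum of the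
first `n` coefficients of `(g ∘ φ) D` in terms of `sup |g|`, while that of `(f ∘ φ) D` is at least
a multiple of `p ^ (N + 1)` (`exists_extremal`).

The Bergman norm of weight `β` is equivalent to that of `l_a^2(-(β + 1) / 2)`, because the moments
of its weight are the values of the Beta function at `(k + 1, β + 1)`, which are comparable to `(k
+ 1) ^ (-(β + 1))` by Euler's limit formula for the Gamma function (`exists_normBergman_equiv`).
-/

namespace DiscInterp

open Metric Filter Topology ComplexConjugate MeasureTheory

/-! ### Taylor coefficients and Parseval's identity -/

lemma hasSum_taylorCoeff {f : ℂ → ℂ} {R : ℝ} (hf : DifferentiableOn ℂ f (ball 0 R)) {z : ℂ}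
    (hz : ‖z‖ < R) : HasSum (fun k ↦ taylorCoeff f k * z ^ k) (f z) := by
  have h := Complex.hasSum_taylorSeries_on_ball hf (z := z) (by simpa using hz)
  refine h.congr_fun fun k ↦ ?_
  simp only [taylorCoeff, smul_eq_mul, sub_zero]
  ring

lemma analyticAt_of_differentiableOn_ball {f : ℂ → ℂ} {R : ℝ}
    (hf : DifferentiableOn ℂ f (ball 0 R)) {z : ℂ} (hz : ‖z‖ < R) : AnalyticAt ℂ f z :=
  hf.analyticAt (isOpen_ball.mem_nhds (by simpa using hz))

lemma taylorCoeff_mul {f g : ℂ → ℂ} (hf : AnalyticAt ℂ f 0) (hg : AnalyticAt ℂ g 0) (n : ℕ) :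
    taylorCoeff (fun z ↦ f z * g z) n =
      ∑ i ∈ Finset.range (n + 1), taylorCoeff f i * taylorCoeff g (n - i) := by
  unfold taylorCoeff
  rw [iteratedDeriv_fun_mul hf.contDiffAt hg.contDiffAt, Finset.sum_div]
  refine Finset.sum_congr rfl fun i hi ↦ ?_
  have hi' : i ≤ n := by simpa [Nat.lt_succ_iff] using hi
  rw [Nat.cast_choose ℂ hi']
  have := Nat.factorial_ne_zero n
  have := Nat.factorial_ne_zero i
  have := Nat.factorial_ne_zero (n - i)
  field_simp

lemma taylorCoeff_sum {ι : Type*} (s : Finset ι) {f : ι → ℂ → ℂ}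
    (hf : ∀ i ∈ s, AnalyticAt ℂ (f i) 0) (n : ℕ) :
    taylorCoeff (fun z ↦ ∑ i ∈ s, f i z) n = ∑ i ∈ s, taylorCoeff (f i) n := by
  unfold taylorCoeff
  rw [iteratedDeriv_fun_sum fun i hi ↦ (hf i hi).contDiffAt, Finset.sum_div]

lemma taylorCoeff_const_mul (f : ℂ → ℂ) (c : ℂ) (n : ℕ) :
    taylorCoeff (fun z ↦ c * f z) n = c * taylorCoeff f n := by
  unfold taylorCoeff
  rw [iteratedDeriv_const_mul_field, mul_div_assoc]

/-- The monomials `1, b, b ^ 2, …` are orthogonal for the harmonic measure of a disc at a point `w`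
when `b` is holomorphic, has constant modulus on the circle and vanishes at `w`. -/
lemma circleAverage_poissonKernel_mul_normSq_sum (c : ℕ → ℂ) {b : ℂ → ℂ} {w : ℂ} {ρ s : ℝ}
    (hw : ‖w‖ < ρ) (hb : DiffContOnCl ℂ b (ball 0 ρ)) (hbs : ∀ z, ‖z‖ = ρ → ‖b z‖ = s)
    (hbw : b w = 0) (n : ℕ) :
    Real.circleAverage
        (fun z ↦ poissonKernel 0 w z * ‖∑ k ∈ Finset.range n, c k * b z ^ k‖ ^ 2) 0 ρ =
      ∑ k ∈ Finset.range n, ‖c k‖ ^ 2 * s ^ (2 * k) := by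
  have hρ : 0 < ρ := (norm_nonneg w).trans_lt hw
  have hwb : w ∈ ball (0 : ℂ) ρ := by simpa using hw
  have hbc : ContinuousOn b (sphere 0 |ρ|) := by
    rw [abs_of_pos hρ]
    refine hb.continuousOn.mono ?_
    rw [closure_ball _ hρ.ne']
    exact sphere_subset_closedBall
  have hPc : ContinuousOn (poissonKernel 0 w) (sphere 0 |ρ|) := by
    rw [poissonKernel_eq_re_herglotzRieszKernel]
    exact Complex.continuous_re.comp_continuousOn (continuousOn_herglotzRieszKernel_sphere hwb)
  have hP : ∀ {F : ℂ → ℂ}, DiffContOnCl ℂ F (ball 0 ρ) →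
      Real.circleAverage (fun z ↦ poissonKernel 0 w z * Complex.reCLM (F z)) 0 ρ = (F w).re := by
    intro F hF
    have hFc : ContinuousOn F (sphere 0 |ρ|) := by
      rw [abs_of_pos hρ]
      refine hF.continuousOn.mono ?_
      rw [closure_ball _ hρ.ne']
      exact sphere_subset_closedBall
    have h := Complex.reCLM.circleAverage_comp_comm (c := 0) (R := ρ)
      ((hPc.smul hFc).circleIntegrable' : CircleIntegrable (poissonKernel 0 w • F) 0 ρ)
    rw [hF.circleAverage_poissonKernel_smul hwb] at h
    simpa [Function.comp_def] using h
  induction n generalizing c with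
  | zero => simp [Real.circleAverage_const]
  | succ n ih =>
    set T : ℂ → ℂ := fun z ↦ ∑ k ∈ Finset.range n, c (k + 1) * b z ^ k with hT
    have hTd : DiffContOnCl ℂ T (ball 0 ρ) := by
      refine ⟨DifferentiableOn.fun_sum fun k _ ↦ (hb.differentiableOn.pow k).const_mul _, ?_⟩
      exact continuousOn_finsetSum _ fun k _ ↦ (hb.continuousOn.pow k).const_smul (c (k + 1))
    have hTc : ContinuousOn T (sphere 0 |ρ|) :=
      continuousOn_finsetSum _ fun k _ ↦ (hbc.pow k).const_smul (c (k + 1))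
    -- On the circle, `‖c₀ + b T‖² = ‖c₀‖² + s² ‖T‖² + 2 Re (conj c₀ b T)`, and the last term has
    -- mean value zero.
    have hsq : Set.EqOn
        (fun z ↦ poissonKernel 0 w z * ‖∑ k ∈ Finset.range (n + 1), c k * b z ^ k‖ ^ 2)
        (fun z ↦ poissonKernel 0 w z * Complex.reCLM
            (((‖c 0‖ ^ 2 : ℝ) : ℂ) + 2 * starRingEnd ℂ (c 0) * (b z * T z)) +
          s ^ 2 • (poissonKernel 0 w z * ‖T z‖ ^ 2)) (sphere 0 |ρ|) := by
      intro z hz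
      have hz' : ‖b z‖ = s := hbs z (by simpa [abs_of_pos hρ] using hz)
      have : ∑ k ∈ Finset.range (n + 1), c k * b z ^ k = c 0 + b z * T z := by
        rw [Finset.sum_range_succ', hT, Finset.mul_sum, add_comm]
        simp only [pow_succ, pow_zero, mul_one]
        congr 1
        exact Finset.sum_congr rfl fun k _ ↦ by ring
      simp only [this]
      rw [← Complex.normSq_eq_norm_sq, Complex.normSq_add, Complex.normSq_eq_norm_sq,
        Complex.normSq_eq_norm_sq, norm_mul, hz', ← Complex.conj_re (c 0 * _)]
      simp only [map_mul, Complex.conj_conj, Complex.reCLM_apply, smul_eq_mul, mul_pow, mul_assoc,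
        Complex.add_re, Complex.ofReal_re]
      simp
      ring
    have hF : DiffContOnCl ℂ
        (fun z ↦ ((‖c 0‖ ^ 2 : ℝ) : ℂ) + 2 * starRingEnd ℂ (c 0) * (b z * T z)) (ball 0 ρ) :=
      diffContOnCl_const.add ((hb.smul hTd).const_smul (2 * starRingEnd ℂ (c 0)))
    rw [Real.circleAverage_congr_sphere hsq, Real.circleAverage_fun_add, hP hF,
      Real.circleAverage_fun_smul, ih]
    · rw [hbw, Finset.sum_range_succ', smul_eq_mul, add_comm]
      congr 1
      · rw [Finset.mul_sum]
        exact Finset.sum_congr rfl fun k _ ↦ by ring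
      · rw [zero_mul, mul_zero, add_zero, Complex.ofReal_re, mul_zero, pow_zero, mul_one]
    · refine ContinuousOn.circleIntegrable' (hPc.mul ?_)
      exact Complex.continuous_re.comp_continuousOn
        (continuousOn_const.add (continuousOn_const.mul (hbc.mul hTc)))
    · exact ((hPc.mul (hTc.norm.pow 2)).const_smul (s ^ 2)).circleIntegrable'

lemma circleAverage_normSq_sum (c : ℕ → ℂ) {ρ : ℝ} (hρ : 0 < ρ) (n : ℕ) :
    Real.circleAverage (fun z ↦ ‖∑ k ∈ Finset.range n, c k * z ^ k‖ ^ 2) 0 ρ =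
      ∑ k ∈ Finset.range n, ‖c k‖ ^ 2 * ρ ^ (2 * k) := by
  rw [← circleAverage_poissonKernel_mul_normSq_sum c (b := fun z ↦ z) (w := 0) (s := ρ)
    (by simpa using hρ) differentiable_id.diffContOnCl (fun _ h ↦ h) rfl n]
  refine Real.circleAverage_congr_sphere fun z hz ↦ ?_
  have : ‖z‖ = ρ := by simpa [abs_of_pos hρ] using hz
  simp [poissonKernel_def, this, hρ.ne']

/-- Parseval's identity on the circle of radius `ρ`. -/
theorem hasSum_normSq_taylorCoeff {f : ℂ → ℂ} {R ρ : ℝ} (hf : DifferentiableOn ℂ f (ball 0 R))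
    (hρ : 0 < ρ) (hρR : ρ < R) :
    HasSum (fun k ↦ ‖taylorCoeff f k‖ ^ 2 * ρ ^ (2 * k))
      (Real.circleAverage (fun z ↦ ‖f z‖ ^ 2) 0 ρ) := by
  rw [hasSum_iff_tendsto_nat_of_nonneg (fun k ↦ by positivity)]
  simp_rw [← circleAverage_normSq_sum _ hρ, Real.circleAverage]
  refine Tendsto.const_smul ?_ _
  have hsum : Summable fun k ↦ ‖taylorCoeff f k‖ * ρ ^ k := by
    have := (hasSum_taylorCoeff hf (z := (ρ : ℂ)) (by simpa [abs_of_pos hρ])).summable.norm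
    simpa [abs_of_pos hρ] using this
  refine intervalIntegral.tendsto_integral_filter_of_dominated_convergence
    (fun _ ↦ (∑' k, ‖taylorCoeff f k‖ * ρ ^ k) ^ 2) ?_ ?_ (by simp) ?_
  · exact Eventually.of_forall fun n ↦ (by fun_prop : Continuous _).aestronglyMeasurable
  · refine Eventually.of_forall fun n ↦ Eventually.of_forall fun θ _ ↦ ?_
    rw [norm_pow, norm_norm]
    gcongr
    refine (norm_sum_le _ _).trans ?_
    simp only [norm_mul, norm_pow, norm_circleMap_zero, abs_of_pos hρ]
    exact hsum.sum_le_tsum _ fun k _ ↦ by positivity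
  · refine Eventually.of_forall fun θ _ ↦ ?_
    exact ((hasSum_taylorCoeff hf (by simpa [abs_of_pos hρ])).tendsto_sum_nat.norm).pow 2

/-- Differentiating the Taylor series termwise, expressed through the derivatives of the
monomials. -/
lemma hasSum_iteratedDeriv {f : ℂ → ℂ} {R : ℝ} (hf : DifferentiableOn ℂ f (ball 0 R)) {z : ℂ}
    (hz : ‖z‖ < R) (i : ℕ) :
    HasSum (fun k ↦ taylorCoeff f k * iteratedDeriv i (fun w ↦ w ^ k) z)
      (iteratedDeriv i f z) := by
  induction i generalizing f with
  | zero => simpa using hasSum_taylorCoeff hf hz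
  | succ i ih =>
    rw [iteratedDeriv_succ']
    have h := ih (hf.deriv isOpen_ball)
    rw [← hasSum_nat_add_iff' 1]
    have h0 : iteratedDeriv (i + 1) (fun w : ℂ ↦ w ^ 0) z = 0 := by
      simp [iteratedDeriv_const]
    simp only [Finset.range_one, Finset.sum_singleton, h0, mul_zero, sub_zero]
    refine h.congr_fun fun k ↦ ?_
    have hd : deriv (fun w : ℂ ↦ w ^ (k + 1)) = fun w ↦ ((k : ℂ) + 1) * w ^ k := by
      ext w; simp
    rw [iteratedDeriv_succ', hd, iteratedDeriv_const_mul_field]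
    have : ((k.factorial : ℕ) : ℂ) ≠ 0 := by exact_mod_cast k.factorial_ne_zero
    have : (k : ℂ) + 1 ≠ 0 := by exact_mod_cast k.succ_ne_zero
    simp only [taylorCoeff, iteratedDeriv_succ', Nat.factorial_succ]
    push_cast
    field_simp

/-! ### Blaschke products and the kernel of the model space -/

/-- The Blaschke factor `(z - a) / (1 - ā z)` with zero `a`. -/
noncomputable def blaschke (a z : ℂ) : ℂ := (z - a) / (1 - conj a * z)

/-- The Blaschke product with zeros `a 0, …, a (m - 1)`. -/
noncomputable def blaschkeProd (a : ℕ → ℂ) (m : ℕ) (z : ℂ) : ℂ :=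
  ∏ i ∈ Finset.range m, blaschke (a i) z

/-- The kernel `(1 - B(z) B♯(w)) / (1 - z w)`, with `B` the Blaschke product of `a 0, …, a (m - 1)`
and `B♯` that of the conjugate points, written as a finite sum of products so that it is visibly
holomorphic also where `z w = 1`. -/
noncomputable def modelKernel (a : ℕ → ℂ) (m : ℕ) (z w : ℂ) : ℂ :=
  ∑ j ∈ Finset.range m, (blaschkeProd a j z * ((1 - ‖a j‖ ^ 2) / (1 - conj (a j) * z))) *
    (blaschkeProd (fun i ↦ conj (a i)) j w / (1 - a j * w))

lemma one_sub_mul_ne_zero {r : ℝ} (hr : 0 ≤ r) (hr1 : r < 1) {a z : ℂ} (ha : ‖a‖ ≤ r)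
    (hz : ‖z‖ < 2 - r) : 1 - a * z ≠ 0 := by
  intro h
  have h1 : a * z = 1 := (sub_eq_zero.mp h).symm
  have h2 : ‖a‖ * ‖z‖ = 1 := by rw [← norm_mul, h1, norm_one]
  have h3 : ‖a‖ * ‖z‖ ≤ r * ‖z‖ := by gcongr
  have h4 : r * ‖z‖ ≤ r * (2 - r) := by gcongr
  nlinarith [sq_pos_of_pos (sub_pos.mpr hr1)]

lemma differentiableOn_blaschke {r : ℝ} (hr : 0 ≤ r) (hr1 : r < 1) {a : ℂ} (ha : ‖a‖ ≤ r) :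
    DifferentiableOn ℂ (blaschke a) (ball 0 (2 - r)) := by
  refine DifferentiableOn.div (by fun_prop) (by fun_prop) fun z hz ↦ ?_
  exact one_sub_mul_ne_zero hr hr1 (by simpa using ha) (by simpa using hz)

lemma differentiableOn_blaschkeProd {r : ℝ} (hr : 0 ≤ r) (hr1 : r < 1) {a : ℕ → ℂ}
    (ha : ∀ i, ‖a i‖ ≤ r) (m : ℕ) :
    DifferentiableOn ℂ (blaschkeProd a m) (ball 0 (2 - r)) := by
  unfold blaschkeProd
  exact DifferentiableOn.fun_finsetProd fun i _ ↦ differentiableOn_blaschke hr hr1 (ha i)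

lemma one_sub_mul_modelKernel {r : ℝ} (hr : 0 ≤ r) (hr1 : r < 1) {a : ℕ → ℂ}
    (ha : ∀ i, ‖a i‖ ≤ r) (m : ℕ) {z w : ℂ} (hz : ‖z‖ < 2 - r) (hw : ‖w‖ < 2 - r) :
    (1 - z * w) * modelKernel a m z w =
      1 - blaschkeProd a m z * blaschkeProd (fun i ↦ conj (a i)) m w := by
  induction m with
  | zero => simp [modelKernel, blaschkeProd]
  | succ m ih =>
    rw [modelKernel, Finset.sum_range_succ, ← modelKernel, mul_add, ih]
    simp only [blaschkeProd, Finset.prod_range_succ]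
    rw [← blaschkeProd, ← blaschkeProd]
    have h1 := one_sub_mul_ne_zero hr hr1 (a := conj (a m)) (by simpa using ha m) hz
    have h2 := one_sub_mul_ne_zero hr hr1 (ha m) hw
    have h3 : ((‖a m‖ : ℂ)) ^ 2 = a m * conj (a m) := (Complex.mul_conj' (a m)).symm
    simp only [blaschke, Complex.conj_conj, h3]
    generalize conj (a m) = c at h1 ⊢
    generalize a m = b at h2 ⊢
    generalize blaschkeProd (fun i ↦ conj (a i)) m w = q
    have h4 : (1 - z * w) * (((1 - b * c) / (1 - c * z)) * (1 - b * w)⁻¹) +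
        (z - b) / (1 - c * z) * ((w - c) / (1 - b * w)) = 1 := by
      rw [mul_comm c z, mul_comm b w] at *
      field_simp
      ring
    linear_combination (blaschkeProd a m z * q) * h4

lemma differentiableOn_modelKernel {r : ℝ} (hr : 0 ≤ r) (hr1 : r < 1) {a : ℕ → ℂ}
    (ha : ∀ i, ‖a i‖ ≤ r) (m : ℕ) (z : ℂ) :
    DifferentiableOn ℂ (modelKernel a m z) (ball 0 (2 - r)) := by
  unfold modelKernel
  refine DifferentiableOn.fun_sum fun j _ ↦ DifferentiableOn.const_mul ?_ _
  refine (differentiableOn_blaschkeProd hr hr1 (fun i ↦ by simpa using ha i) j).div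
    (by fun_prop) fun w hw ↦ ?_
  exact one_sub_mul_ne_zero hr hr1 (ha j) (by simpa using hw)

lemma normSq_sub_sub_normSq (a z : ℂ) :
    ‖z - a‖ ^ 2 - ‖1 - conj a * z‖ ^ 2 = (‖z‖ ^ 2 - 1) * (1 - ‖a‖ ^ 2) := by
  simp only [← Complex.normSq_eq_norm_sq, Complex.normSq_apply]
  simp
  ring

lemma norm_blaschke_le_one {a z : ℂ} (ha : ‖a‖ ≤ 1) (hz : ‖z‖ ≤ 1) : ‖blaschke a z‖ ≤ 1 := by
  rw [blaschke, norm_div]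
  refine div_le_one_of_le₀ ?_ (norm_nonneg _)
  refine abs_le_of_sq_le_sq' ?_ (norm_nonneg _) |>.2
  have := normSq_sub_sub_normSq a z
  nlinarith [mul_nonneg (sub_nonneg.mpr (pow_le_one₀ (n := 2) (norm_nonneg z) hz))
    (sub_nonneg.mpr (pow_le_one₀ (n := 2) (norm_nonneg a) ha))]

/-- Just outside the unit circle, at the distance `(1 - r) / (4 n)`, a Blaschke factor with zero in
the disc of radius `r` exceeds `1` by `O(1 / n)` only. -/
lemma norm_blaschke_sq_le {r : ℝ} (hr1 : r < 1) {n : ℕ} (hn : 1 ≤ n) {a z : ℂ}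
    (ha : ‖a‖ ≤ r) (hz : ‖z‖ = 1 + (1 - r) / (4 * n)) : ‖blaschke a z‖ ^ 2 ≤ 1 + 6 / n := by
  have hn' : (1 : ℝ) ≤ n := by exact_mod_cast hn
  have hn0 : (0 : ℝ) < n := by linarith
  have ha0 := norm_nonneg a
  set δ : ℝ := (1 - r) / (4 * n) with hδ
  have hδ0 : 0 < δ := by rw [hδ]; apply div_pos <;> linarith
  have hδn : δ * (4 * n) = 1 - r := by rw [hδ]; field_simp
  have hδ4 : 4 * δ ≤ 1 - r := by nlinarith
  have hden : (1 - ‖a‖) / 2 ≤ ‖1 - conj a * z‖ := by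
    have h1 : ‖(1 : ℂ)‖ - ‖conj a * z‖ ≤ ‖1 - conj a * z‖ := norm_sub_norm_le _ _
    rw [norm_one, norm_mul, RCLike.norm_conj, hz] at h1
    nlinarith
  have hpos : 0 < ‖1 - conj a * z‖ := lt_of_lt_of_le (by linarith) hden
  rw [blaschke, norm_div, div_pow, div_le_iff₀ (by positivity)]
  have key := normSq_sub_sub_normSq a z
  have h1 : (‖z‖ ^ 2 - 1) * (1 - ‖a‖ ^ 2) ≤ 6 / n * ‖1 - conj a * z‖ ^ 2 := by
    have h2 : ((1 - ‖a‖) / 2) ^ 2 ≤ ‖1 - conj a * z‖ ^ 2 := by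
      apply pow_le_pow_left₀ _ hden; linarith
    calc (‖z‖ ^ 2 - 1) * (1 - ‖a‖ ^ 2) ≤ (3 * δ) * (2 * (1 - ‖a‖)) := by
          rw [hz]
          apply mul_le_mul <;> nlinarith
      _ ≤ 6 / n * ((1 - ‖a‖) / 2) ^ 2 := by
          rw [div_mul_eq_mul_div, le_div_iff₀ hn0]
          have : δ * n * 4 ≤ 1 - ‖a‖ := by linarith
          nlinarith [mul_le_mul_of_nonneg_right this (by linarith : (0 : ℝ) ≤ 1 - ‖a‖)]
      _ ≤ _ := by gcongr
  linarith

lemma norm_blaschkeProd_le_one {a : ℕ → ℂ} (ha : ∀ i, ‖a i‖ ≤ 1) (m : ℕ) {z : ℂ} (hz : ‖z‖ ≤ 1) :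
    ‖blaschkeProd a m z‖ ≤ 1 := by
  rw [blaschkeProd, norm_prod]
  exact Finset.prod_le_one (fun _ _ ↦ norm_nonneg _) fun i _ ↦ norm_blaschke_le_one (ha i) hz

lemma norm_blaschkeProd_le_exp {r : ℝ} (hr1 : r < 1) {n m : ℕ} (hn : 1 ≤ n) (hm : m ≤ n)
    {a : ℕ → ℂ} (ha : ∀ i, ‖a i‖ ≤ r) {z : ℂ} (hz : ‖z‖ = 1 + (1 - r) / (4 * n)) :
    ‖blaschkeProd a m z‖ ≤ Real.exp 3 := by
  have hn' : (1 : ℝ) ≤ n := by exact_mod_cast hn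
  refine abs_le_of_sq_le_sq' ?_ (Real.exp_pos _).le |>.2
  rw [blaschkeProd, norm_prod, ← Finset.prod_pow]
  calc ∏ i ∈ Finset.range m, ‖blaschke (a i) z‖ ^ 2
      ≤ ∏ i ∈ Finset.range m, Real.exp (6 / n) := by
        refine Finset.prod_le_prod (fun _ _ ↦ by positivity) fun i _ ↦ ?_
        have := Real.add_one_le_exp (6 / (n : ℝ))
        linarith [norm_blaschke_sq_le hr1 hn (ha i) hz]
    _ = Real.exp (m * (6 / n)) := by simp [Real.exp_nat_mul]
    _ ≤ Real.exp 6 := by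
        apply Real.exp_le_exp.mpr
        rw [← mul_div_assoc, div_le_iff₀ (by linarith)]
        have : (m : ℝ) ≤ n := by exact_mod_cast hm
        linarith
    _ = Real.exp 3 ^ 2 := by rw [← Real.exp_nat_mul]; norm_num

/-- The Poisson integral of the constant `1`. -/
lemma circleAverage_inv_normSq_sub {ρ : ℝ} {w : ℂ} (hw : ‖w‖ < ρ) :
    Real.circleAverage (fun z ↦ (‖z - w‖ ^ 2)⁻¹) 0 ρ = (ρ ^ 2 - ‖w‖ ^ 2)⁻¹ := by
  have hρ : 0 < ρ := (norm_nonneg w).trans_lt hw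
  have h1 := InnerProductSpace.HarmonicOnNhd.circleAverage_poissonKernel_smul
    (f := fun _ ↦ (1 : ℝ)) (c := 0) (w := w) (R := ρ)
    (fun _ _ ↦ InnerProductSpace.harmonicAt_const 1) (by simpa using hw)
  have h2 : Set.EqOn (poissonKernel 0 w • fun _ ↦ (1 : ℝ))
      (fun z ↦ (ρ ^ 2 - ‖w‖ ^ 2) • (‖z - w‖ ^ 2)⁻¹) (sphere 0 |ρ|) := by
    intro z hz
    have : ‖z‖ = ρ := by simpa [abs_of_pos hρ] using hz
    simp [poissonKernel_def, this, div_eq_mul_inv]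
  rw [Real.circleAverage_congr_sphere h2, Real.circleAverage_fun_smul, smul_eq_mul] at h1
  exact eq_inv_of_mul_eq_one_right h1

/-- For `|z| = 1`, the kernel has mean square `O(n / (1 - r))` on the circle of radius
`1 + (1 - r) / (4 n)`. -/
lemma circleAverage_normSq_modelKernel_le {r : ℝ} (hr : 0 ≤ r) (hr1 : r < 1) {n m : ℕ}
    (hn : 1 ≤ n) (hm : m ≤ n) {a : ℕ → ℂ} (ha : ∀ i, ‖a i‖ ≤ r) {z : ℂ} (hz : ‖z‖ = 1) :
    Real.circleAverage (fun w ↦ ‖modelKernel a m z w‖ ^ 2) 0 (1 + (1 - r) / (4 * n)) ≤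
      (1 + Real.exp 3) ^ 2 * (2 * n / (1 - r)) := by
  have hn' : (1 : ℝ) ≤ n := by exact_mod_cast hn
  set ρ : ℝ := 1 + (1 - r) / (4 * n) with hρ
  have hδ0 : 0 < (1 - r) / (4 * n) := by apply div_pos <;> linarith
  have hδ1 : (1 - r) / (4 * n) < 1 - r := by
    rw [div_lt_iff₀ (by linarith)]; nlinarith
  have hρ1 : 1 < ρ := by linarith
  have hρ0 : 0 < ρ := by linarith
  have hρR : ρ < 2 - r := by linarith
  have hz0 : z ≠ 0 := norm_ne_zero_iff.mp (by rw [hz]; exact one_ne_zero)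
  have hw0 : ‖z⁻¹‖ < ρ := by rw [norm_inv, hz, inv_one]; exact hρ1
  have hpt : ∀ w ∈ sphere (0 : ℂ) |ρ|,
      ‖modelKernel a m z w‖ ^ 2 ≤ (1 + Real.exp 3) ^ 2 • (‖w - z⁻¹‖ ^ 2)⁻¹ := by
    intro w hw
    have hw' : ‖w‖ = ρ := by simpa [abs_of_pos hρ0] using hw
    have hne : 0 < ‖w - z⁻¹‖ := by
      refine norm_pos_iff.mpr (sub_ne_zero.mpr ?_)
      rintro rfl
      exact hw0.ne hw'
    have h1 : ‖1 - z * w‖ = ‖w - z⁻¹‖ := by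
      have : 1 - z * w = -(z * (w - z⁻¹)) := by field_simp; ring
      rw [this, norm_neg, norm_mul, hz, one_mul]
    have h2 := congrArg norm (one_sub_mul_modelKernel hr hr1 ha m (z := z) (w := w)
      (by rw [hz]; linarith) (by rw [hw']; exact hρR))
    rw [norm_mul, h1] at h2
    have h3 : ‖w - z⁻¹‖ * ‖modelKernel a m z w‖ ≤ 1 + Real.exp 3 := by
      rw [h2]
      refine (norm_sub_le _ _).trans ?_
      rw [norm_one, norm_mul]
      have h4 := norm_blaschkeProd_le_one (fun i ↦ (ha i).trans hr1.le) m hz.le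
      have h5 := norm_blaschkeProd_le_exp hr1 hn hm (a := fun i ↦ conj (a i))
        (fun i ↦ by simpa using ha i) hw'
      have := mul_le_mul h4 h5 (norm_nonneg _) zero_le_one
      linarith
    rw [smul_eq_mul, ← div_eq_mul_inv, le_div_iff₀ (by positivity), ← mul_pow, mul_comm]
    gcongr
  refine (Real.circleAverage_mono ?_ ?_ hpt).trans ?_
  · refine ContinuousOn.circleIntegrable' ?_
    refine ((differentiableOn_modelKernel hr hr1 ha m z).continuousOn.mono ?_).norm.pow 2
    intro w hw
    have : ‖w‖ = ρ := by simpa [abs_of_pos hρ0] using hw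
    simpa [this] using hρR
  · refine ContinuousOn.circleIntegrable' ?_
    have hc : Continuous fun w : ℂ ↦ ‖w - z⁻¹‖ ^ 2 := by fun_prop
    suffices h : ContinuousOn (fun w : ℂ ↦ (‖w - z⁻¹‖ ^ 2)⁻¹) (sphere 0 |ρ|) from
      continuousOn_const.fun_smul h
    refine hc.continuousOn.inv₀ fun w hw ↦ ?_
    have hw' : ‖w‖ = ρ := by simpa [abs_of_pos hρ0] using hw
    refine pow_ne_zero _ (norm_ne_zero_iff.mpr (sub_ne_zero.mpr ?_))
    rintro rfl
    exact hw0.ne hw'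
  · rw [Real.circleAverage_fun_smul, circleAverage_inv_normSq_sub hw0, smul_eq_mul, norm_inv, hz]
    gcongr
    rw [inv_le_comm₀ (by nlinarith) (by apply div_pos <;> linarith), inv_div]
    have : (1 - r) / (2 * n) = 2 * ((1 - r) / (4 * n)) := by ring
    rw [this]
    nlinarith

/-! ### Pairing with functions holomorphic beyond the unit circle -/

lemma hasSum_of_normLa2_lt_top {α : ℝ} {f : ℂ → ℂ} (hf : normLa2 α f < ∞) :
    HasSum (fun k : ℕ ↦ ‖taylorCoeff f k‖ ^ 2 * ((k : ℝ) + 1) ^ (2 * α))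
      ((normLa2 α f).toReal ^ 2) := by
  have hpos : ∀ k : ℕ, 0 ≤ ‖taylorCoeff f k‖ ^ 2 * ((k : ℝ) + 1) ^ (2 * α) :=
    fun k ↦ by positivity
  have hterm : ∀ k : ℕ, ‖taylorCoeff f k‖ₑ ^ 2 * ENNReal.ofReal (((k : ℝ) + 1) ^ (2 * α)) =
      ENNReal.ofReal (‖taylorCoeff f k‖ ^ 2 * ((k : ℝ) + 1) ^ (2 * α)) := by
    intro k
    rw [ENNReal.ofReal_mul (by positivity), ENNReal.ofReal_pow (norm_nonneg _), ofReal_norm]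
  unfold normLa2 at hf ⊢
  simp_rw [hterm] at hf ⊢
  have hne : ∑' k : ℕ, ENNReal.ofReal (‖taylorCoeff f k‖ ^ 2 * ((k : ℝ) + 1) ^ (2 * α)) ≠ ∞ := by
    intro h
    rw [h, ENNReal.top_rpow_of_pos (by norm_num)] at hf
    exact hf.ne rfl
  have hs : Summable fun k : ℕ ↦ ‖taylorCoeff f k‖ ^ 2 * ((k : ℝ) + 1) ^ (2 * α) := by
    have := ENNReal.summable_toReal hne
    simpa only [ENNReal.toReal_ofReal (hpos _)] using this
  rw [← ENNReal.ofReal_tsum_of_nonneg hpos hs, ← ENNReal.toReal_rpow,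
    ENNReal.toReal_ofReal (tsum_nonneg hpos), ← Real.sqrt_eq_rpow,
    Real.sq_sqrt (tsum_nonneg hpos)]
  exact hs.hasSum

/-- Geometric growth dominates polynomial growth, with the correct dependence on the ratio. -/
lemma rpow_le_mul_one_add_pow {s t : ℝ} (hs : 0 ≤ s) (ht : 0 < t) (ht1 : t ≤ 1) (k : ℕ) :
    ((k : ℝ) + 1) ^ s ≤ 2 * (2 * s) ^ s * t ^ (-s) * (1 + t) ^ (2 * k) := by
  have hk : (0 : ℝ) < (k : ℝ) + 1 := by positivity
  set x : ℝ := (k + 1) * t with hx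
  have hx0 : 0 < x := by positivity
  have h1 : x ^ s ≤ (2 * s) ^ s * Real.exp (x / 2) := by
    rcases hs.eq_or_lt with rfl | hs
    · simpa using (by positivity : 0 ≤ x / 2)
    · have h2 : x ≤ 2 * s * Real.exp (x / (2 * s)) := by
        have := Real.add_one_le_exp (x / (2 * s))
        calc x = 2 * s * (x / (2 * s)) := by field_simp
          _ ≤ _ := by gcongr; linarith
      calc x ^ s ≤ (2 * s * Real.exp (x / (2 * s))) ^ s := by gcongr
        _ = (2 * s) ^ s * Real.exp (x / 2) := by
          rw [Real.mul_rpow (by positivity) (by positivity), ← Real.exp_mul]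
          congr 2
          field_simp
  have h3 : Real.exp (x / 2) ≤ 2 * (1 + t) ^ (2 * k) := by
    have h4 : Real.exp (t / 2) ≤ 1 + t := by
      have h5 := Real.add_one_le_exp (-(t / 2))
      rw [Real.exp_neg] at h5
      have h6 := Real.exp_pos (t / 2)
      have h7 : (1 - t / 2) * Real.exp (t / 2) ≤ 1 := by
        calc (1 - t / 2) * Real.exp (t / 2) ≤ (Real.exp (t / 2))⁻¹ * Real.exp (t / 2) := by
              gcongr; linarith
          _ = 1 := inv_mul_cancel₀ h6.ne'
      nlinarith
    have h5 : Real.exp (x / 2) = Real.exp (t / 2) ^ (k + 1) := by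
      rw [← Real.exp_nat_mul, hx]; push_cast; congr 1; ring
    rw [h5]
    calc Real.exp (t / 2) ^ (k + 1) ≤ (1 + t) ^ (k + 1) := by gcongr
      _ ≤ 2 * (1 + t) ^ (2 * k) := by
        rcases k with _ | k
        · simp; linarith
        · have : (1 + t) ^ (k + 1 + 1) ≤ (1 + t) ^ (2 * (k + 1)) :=
            pow_le_pow_right₀ (by linarith) (by omega)
          have h0 : 0 ≤ (1 + t) ^ (2 * (k + 1)) := by positivity
          linarith
  have h8 : ((k : ℝ) + 1) ^ s = x ^ s * t ^ (-s) := by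
    rw [hx, Real.mul_rpow hk.le ht.le, mul_assoc, ← Real.rpow_add ht]
    simp
  rw [h8]
  calc x ^ s * t ^ (-s) ≤ ((2 * s) ^ s * (2 * (1 + t) ^ (2 * k))) * t ^ (-s) := by
        gcongr
        exact h1.trans (by gcongr)
    _ = _ := by ring

/-- The Cauchy pairing of `f ∈ l_a^2(α)` with a function `H` holomorphic in a larger disc, bounded
by the mean square of `H` on the circle of radius `1 + t`. -/
theorem pairing_le {α : ℝ} (hα : α ≤ 0) {f H : ℂ → ℂ} (hf : normLa2 α f < ∞) {R t M : ℝ}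
    (ht : 0 < t) (ht1 : t ≤ 1) (htR : 1 + t < R) (hH : DifferentiableOn ℂ H (ball 0 R))
    (hM : Real.circleAverage (fun w ↦ ‖H w‖ ^ 2) 0 (1 + t) ≤ M) :
    Summable (fun k ↦ ‖taylorCoeff f k * taylorCoeff H k‖) ∧
      ∑' k, ‖taylorCoeff f k * taylorCoeff H k‖ ≤
        (normLa2 α f).toReal * √(2 * (-4 * α) ^ (-2 * α) * t ^ (2 * α) * M) := by
  have hs : 0 ≤ -2 * α := by linarith
  have hu := hasSum_of_normLa2_lt_top hf
  set u : ℕ → ℝ := fun k ↦ ‖taylorCoeff f k‖ * ((k : ℝ) + 1) ^ α with hu'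
  set v : ℕ → ℝ := fun k ↦ ‖taylorCoeff H k‖ * ((k : ℝ) + 1) ^ (-α) with hv'
  set C : ℝ := 2 * (-4 * α) ^ (-2 * α) * t ^ (2 * α) with hC
  have hC0 : 0 ≤ C := by
    have : 0 ≤ -4 * α := by linarith
    positivity
  have hu2 : ∀ k, u k ^ (2 : ℝ) = ‖taylorCoeff f k‖ ^ 2 * ((k : ℝ) + 1) ^ (2 * α) := by
    intro k
    rw [Real.rpow_two, hu', mul_pow, ← Real.rpow_natCast (_ ^ α), ← Real.rpow_mul (by positivity)]
    congr 2
    push_cast; ring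
  have hv2 : ∀ k, v k ^ (2 : ℝ) ≤ C * (‖taylorCoeff H k‖ ^ 2 * (1 + t) ^ (2 * k)) := by
    intro k
    have h1 : (((k : ℝ) + 1) ^ (-α)) ^ 2 = ((k : ℝ) + 1) ^ (-2 * α) := by
      rw [← Real.rpow_natCast (_ ^ (-α)), ← Real.rpow_mul (by positivity)]
      congr 1
      push_cast; ring
    have h2 := rpow_le_mul_one_add_pow hs ht ht1 k
    have h3 : 2 * (2 * (-2 * α)) ^ (-2 * α) * t ^ (-(-2 * α)) = C := by
      rw [hC]; congr 3 <;> ring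
    rw [h3] at h2
    rw [Real.rpow_two, hv', mul_pow, h1]
    calc ‖taylorCoeff H k‖ ^ 2 * ((k : ℝ) + 1) ^ (-2 * α)
        ≤ ‖taylorCoeff H k‖ ^ 2 * (C * (1 + t) ^ (2 * k)) := by gcongr
      _ = _ := by ring
  have hP := (hasSum_normSq_taylorCoeff hH (by linarith) htR).mul_left C
  have hvs : Summable fun k ↦ v k ^ (2 : ℝ) :=
    Summable.of_nonneg_of_le (fun k ↦ by positivity) hv2 hP.summable
  have huv : ∀ k, ‖taylorCoeff f k * taylorCoeff H k‖ = u k * v k := by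
    intro k
    have : ((k : ℝ) + 1) ^ α * ((k : ℝ) + 1) ^ (-α) = 1 := by
      rw [← Real.rpow_add (by positivity)]; simp
    rw [norm_mul, hu', hv']
    linear_combination (-(‖taylorCoeff f k‖ * ‖taylorCoeff H k‖)) * this
  have hus : HasSum (fun k ↦ u k ^ (2 : ℝ)) ((normLa2 α f).toReal ^ 2) := by
    simpa only [hu2] using hu
  obtain ⟨h1, h2⟩ := Real.summable_and_inner_le_Lp_mul_Lq_tsum_of_nonneg
    (p := 2) (q := 2) (f := u) (g := v) Real.HolderConjugate.two_two
    (fun k ↦ by positivity) (fun k ↦ by positivity) hus.summable hvs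
  simp_rw [huv]
  refine ⟨h1, h2.trans ?_⟩
  rw [hus.tsum_eq, ← Real.sqrt_eq_rpow, ← Real.sqrt_eq_rpow, Real.sqrt_sq ENNReal.toReal_nonneg]
  gcongr
  calc ∑' k, v k ^ (2 : ℝ) ≤ _ := hvs.tsum_le_tsum hv2 hP.summable
    _ = _ := hP.tsum_eq
    _ ≤ C * M := by gcongr

/-! ### Interpolation with the trace of the kernel -/

lemma taylorCoeff_id_mul {H : ℂ → ℂ} (hH : AnalyticAt ℂ H 0) (k : ℕ) :
    taylorCoeff (fun w ↦ w * H w) (k + 1) = taylorCoeff H k := by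
  have h := taylorCoeff_mul (f := fun w ↦ w) analyticAt_id hH (k + 1)
  have h0 : taylorCoeff (fun w : ℂ ↦ w) 0 = 0 := by simp [taylorCoeff]
  have h1 : taylorCoeff (fun w : ℂ ↦ w) 1 = 1 := by simp [taylorCoeff]
  have h2 : ∀ i, taylorCoeff (fun w : ℂ ↦ w) (i + 2) = 0 := by
    intro i
    simp [taylorCoeff, iteratedDeriv_succ', iteratedDeriv_const]
  rw [h, Finset.sum_range_succ', Finset.sum_range_succ']
  simp [h0, h1, h2]

/-- The `k`-th coefficient in `w` of the kernel differs from `z ^ k` by a multiple of the Blaschke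
product: it interpolates `z ^ k` at the zeros of that product. -/
lemma exists_taylorCoeff_modelKernel {r : ℝ} (hr : 0 ≤ r) (hr1 : r < 1) {a : ℕ → ℂ}
    (ha : ∀ i, ‖a i‖ ≤ r) (m k : ℕ) :
    ∃ p : ℂ → ℂ, Differentiable ℂ p ∧ ∀ z, ‖z‖ < 2 - r →
      taylorCoeff (modelKernel a m z) k = z ^ k - blaschkeProd a m z * p z := by
  have h0R : ‖(0 : ℂ)‖ < 2 - r := by rw [norm_zero]; linarith
  set b : ℂ → ℂ := blaschkeProd (fun i ↦ conj (a i)) m with hb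
  have hbA : AnalyticAt ℂ b 0 := analyticAt_of_differentiableOn_ball
    (differentiableOn_blaschkeProd hr hr1 (fun i ↦ by simpa using ha i) m) h0R
  have hKA : ∀ z, AnalyticAt ℂ (modelKernel a m z) 0 := fun z ↦
    analyticAt_of_differentiableOn_ball (differentiableOn_modelKernel hr hr1 ha m z) h0R
  -- Coefficients of both sides of `K(z, w) = 1 - B(z) B♯(w) + z w K(z, w)`.
  have hid : ∀ z, ‖z‖ < 2 - r → ∀ k, taylorCoeff (modelKernel a m z) k =
      taylorCoeff (fun _ ↦ (1 : ℂ)) k - blaschkeProd a m z * taylorCoeff b k +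
        z * taylorCoeff (fun w ↦ w * modelKernel a m z w) k := by
    intro z hz k
    have hev : modelKernel a m z =ᶠ[𝓝 0] fun w ↦ ∑ i : Fin 3, (![fun _ ↦ (1 : ℂ),
        fun w ↦ (-blaschkeProd a m z) * b w, fun w ↦ z * (w * modelKernel a m z w)] :
          Fin 3 → ℂ → ℂ) i w := by
      filter_upwards [isOpen_ball.mem_nhds (show (0 : ℂ) ∈ ball 0 (2 - r) by simpa using h0R)]
        with w hw
      have := one_sub_mul_modelKernel hr hr1 ha m hz (w := w) (by simpa using hw)
      simp only [Fin.sum_univ_three, Matrix.cons_val_zero, Matrix.cons_val_one, Matrix.cons_val]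
      linear_combination this
    have h1 : taylorCoeff (modelKernel a m z) k = _ := congrArg (· / (k.factorial : ℂ))
      (hev.iteratedDeriv_eq k)
    rw [h1]
    refine (taylorCoeff_sum Finset.univ ?_ k).trans ?_
    · intro i _
      fin_cases i
      · exact analyticAt_const
      · exact analyticAt_const.fun_mul hbA
      · exact analyticAt_const.fun_mul (analyticAt_id.fun_mul (hKA z))
    · simp only [Fin.sum_univ_three, Matrix.cons_val_zero, Matrix.cons_val_one, Matrix.cons_val]
      rw [taylorCoeff_const_mul, taylorCoeff_const_mul]
      ring
  induction k with
  | zero =>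
    refine ⟨fun _ ↦ taylorCoeff b 0, by fun_prop, fun z hz ↦ ?_⟩
    rw [hid z hz]
    simp [taylorCoeff]
  | succ k ih =>
    obtain ⟨p, hp, hpz⟩ := ih
    refine ⟨fun z ↦ taylorCoeff b (k + 1) + z * p z, by fun_prop, fun z hz ↦ ?_⟩
    rw [hid z hz, taylorCoeff_id_mul (hKA z), hpz z hz]
    have : taylorCoeff (fun _ ↦ (1 : ℂ)) (k + 1) = 0 := by
      simp [taylorCoeff, iteratedDeriv_const]
    rw [this]
    ring

lemma count_le_analyticOrderAt_blaschkeProd {a : ℕ → ℂ} (ha : ∀ i, ‖a i‖ < 1) (m : ℕ)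
    {z : ℂ} (hz : ‖z‖ < 1) :
    ((Multiset.count z ((Multiset.range m).map a) : ℕ) : ℕ∞) ≤
      analyticOrderAt (blaschkeProd a m) z := by
  have hA : ∀ i, AnalyticAt ℂ (blaschke (a i)) z := fun i ↦
    analyticAt_of_differentiableOn_ball
      (differentiableOn_blaschke (norm_nonneg _) (ha i) le_rfl) (by linarith [ha i])
  induction m with
  | zero => simp
  | succ m ih =>
    have h1 : blaschkeProd a (m + 1) = blaschkeProd a m * blaschke (a m) := by
      ext w; simp [blaschkeProd, Finset.prod_range_succ]
    have h2 : AnalyticAt ℂ (blaschkeProd a m) z := by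
      unfold blaschkeProd
      exact Finset.analyticAt_fun_prod _ fun i _ ↦ hA i
    rw [h1, analyticOrderAt_mul h2 (hA m), Multiset.range_succ, Multiset.map_cons,
      Multiset.count_cons]
    push_cast
    refine add_le_add ih ?_
    split_ifs with h
    · rw [Order.one_le_iff_ne_zero, (hA m).analyticOrderAt_ne_zero, blaschke, h,
        sub_self, zero_div]
    · simp

lemma exists_eq_map_range (σ : Multiset ℂ) {r : ℝ} (hr : 0 ≤ r) (h : ∀ z ∈ σ, ‖z‖ ≤ r) :
    ∃ a : ℕ → ℂ, (∀ i, ‖a i‖ ≤ r) ∧ σ = (Multiset.range σ.card).map a := by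
  induction σ using Quotient.inductionOn with
  | h l =>
    refine ⟨fun i ↦ l.getD i 0, fun i ↦ ?_, ?_⟩
    · by_cases hi : i < l.length
      · simp only [List.getD_eq_getElem _ _ hi]
        exact h _ (by simp)
      · simp only [List.getD_eq_default _ _ (not_lt.mp hi), norm_zero]
        exact hr
    · simp only [Multiset.quot_mk_to_coe, Multiset.coe_card, Multiset.range, Multiset.map_coe]
      congr 1
      refine List.ext_getElem (by simp) fun i h1 h2 ↦ ?_
      simp [List.getElem?_eq_getElem h1]

/-- Every `f ∈ l_a^2(α)` has an interpolant bounded by the norm of `f`, up to a factor depending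
only on `α`, `n` and `r`. -/
theorem exists_interpolant {α : ℝ} (hα : α ≤ 0) {n : ℕ} (hn : 1 ≤ n) {r : ℝ} (hr : 0 ≤ r)
    (hr1 : r < 1) {σ : Multiset ℂ} (hσn : σ.card ≤ n) (hσr : ∀ z ∈ σ, ‖z‖ ≤ r) {f : ℂ → ℂ}
    (hf : f ∈ Hol) (hfN : normLa2 α f < ∞) :
    ∃ g ∈ Hol, SameTrace σ g f ∧ ∀ z ∈ ball (0 : ℂ) 1, ‖g z‖ ≤
      (normLa2 α f).toReal * √(2 * (-4 * α) ^ (-2 * α) * ((1 - r) / (4 * n)) ^ (2 * α) *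
        ((1 + Real.exp 3) ^ 2 * (2 * n / (1 - r)))) := by
  obtain ⟨a, ha, hσ⟩ := exists_eq_map_range σ hr hσr
  set m := σ.card with hm
  have hn' : (1 : ℝ) ≤ n := by exact_mod_cast hn
  have ht0 : 0 < (1 - r) / (4 * n) := by apply div_pos <;> linarith
  have ht1 : (1 - r) / (4 * n) < 1 - r := by
    rw [div_lt_iff₀ (by linarith)]; nlinarith
  have htR : 1 + (1 - r) / (4 * n) < 2 - r := by linarith
  -- The two factors of the `j`-th summand of the kernel.
  set E : ℕ → ℂ → ℂ := fun j z ↦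
    blaschkeProd a j z * ((1 - ‖a j‖ ^ 2) / (1 - conj (a j) * z)) with hE
  set F : ℕ → ℂ → ℂ := fun j w ↦
    blaschkeProd (fun i ↦ conj (a i)) j w / (1 - a j * w) with hF
  have hK : ∀ z, modelKernel a m z = fun w ↦ ∑ j ∈ Finset.range m, E j z * F j w := fun z ↦ rfl
  have hEd : ∀ j, DifferentiableOn ℂ (E j) (ball 0 (2 - r)) := fun j ↦
    (differentiableOn_blaschkeProd hr hr1 ha j).mul (DifferentiableOn.div (by fun_prop)
      (by fun_prop) fun z hz ↦
        one_sub_mul_ne_zero hr hr1 (by simpa using ha j) (by simpa using hz))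
  have hFd : ∀ j, DifferentiableOn ℂ (F j) (ball 0 (2 - r)) := fun j ↦
    (differentiableOn_blaschkeProd hr hr1 (fun i ↦ by simpa using ha i) j).div
      (by fun_prop) fun w hw ↦ one_sub_mul_ne_zero hr hr1 (ha j) (by simpa using hw)
  have hFA : ∀ j, AnalyticAt ℂ (F j) 0 := fun j ↦
    analyticAt_of_differentiableOn_ball (hFd j) (by rw [norm_zero]; linarith)
  have hKc : ∀ z k, taylorCoeff (modelKernel a m z) k =
      ∑ j ∈ Finset.range m, E j z * taylorCoeff (F j) k := by
    intro z k
    rw [hK, taylorCoeff_sum _ fun j _ ↦ analyticAt_const.fun_mul (hFA j)]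
    simp_rw [taylorCoeff_const_mul]
  have hsum : ∀ j, HasSum (fun k ↦ taylorCoeff f k * taylorCoeff (F j) k)
      (∑' k, taylorCoeff f k * taylorCoeff (F j) k) := fun j ↦
    ((pairing_le hα hfN ht0 (by linarith) htR (hFd j) le_rfl).1.of_norm).hasSum
  set L : ℕ → ℂ := fun j ↦ ∑' k, taylorCoeff f k * taylorCoeff (F j) k with hL
  set g : ℂ → ℂ := fun z ↦ ∑ j ∈ Finset.range m, L j * E j z with hg
  have hgd : DifferentiableOn ℂ g (ball 0 (2 - r)) :=
    DifferentiableOn.fun_sum fun j _ ↦ (hEd j).const_mul _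
  have hgs : ∀ z, HasSum (fun k ↦ taylorCoeff f k * taylorCoeff (modelKernel a m z) k) (g z) := by
    intro z
    have := hasSum_sum fun j (_ : j ∈ Finset.range m) ↦ (hsum j).mul_right (E j z)
    refine this.congr_fun fun k ↦ ?_
    rw [hKc, Finset.mul_sum]
    exact Finset.sum_congr rfl fun j _ ↦ by ring
  refine ⟨g, hgd.mono (ball_subset_ball (by linarith)), ?_, ?_⟩
  · intro z hz i hi
    have hzr := hσr z hz
    have hzR : ‖z‖ < 2 - r := by linarith
    have hEA : ∀ j, AnalyticAt ℂ (E j) z := fun j ↦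
      analyticAt_of_differentiableOn_ball (hEd j) hzR
    have h1 : iteratedDeriv i g z = ∑ j ∈ Finset.range m, L j * iteratedDeriv i (E j) z := by
      rw [hg, iteratedDeriv_fun_sum fun j _ ↦ (analyticAt_const.fun_mul (hEA j)).contDiffAt]
      simp_rw [iteratedDeriv_const_mul_field]
    have h2 : HasSum (fun k ↦ taylorCoeff f k * iteratedDeriv i (fun w ↦ w ^ k) z)
        (iteratedDeriv i g z) := by
      rw [h1]
      have := hasSum_sum fun j (_ : j ∈ Finset.range m) ↦
        (hsum j).mul_right (iteratedDeriv i (E j) z)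
      refine this.congr_fun fun k ↦ ?_
      obtain ⟨p, hp, hpz⟩ := exists_taylorCoeff_modelKernel hr hr1 ha m k
      have hBA : AnalyticAt ℂ (blaschkeProd a m) z := analyticAt_of_differentiableOn_ball
        (differentiableOn_blaschkeProd hr hr1 ha m) hzR
      have hpA : AnalyticAt ℂ p z := hp.analyticAt z
      have hev : (fun w ↦ ∑ j ∈ Finset.range m, taylorCoeff (F j) k * E j w) =ᶠ[𝓝 z]
          fun w ↦ w ^ k - (blaschkeProd a m * p) w := by
        filter_upwards [isOpen_ball.mem_nhds (show z ∈ ball 0 (2 - r) by simpa using hzR)]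
          with w hw
        rw [Pi.mul_apply, ← hpz w (by simpa using hw), hKc]
        exact Finset.sum_congr rfl fun j _ ↦ by ring
      have hvan : iteratedDeriv i (blaschkeProd a m * p) z = 0 := by
        have hord : ((Multiset.count z σ : ℕ) : ℕ∞) ≤ analyticOrderAt (blaschkeProd a m * p) z := by
          rw [analyticOrderAt_mul hBA hpA]
          refine le_add_right ?_
          nth_rewrite 1 [hσ]
          exact count_le_analyticOrderAt_blaschkeProd
            (fun i ↦ (ha i).trans_lt hr1) m (hzr.trans_lt hr1)
        exact (natCast_le_analyticOrderAt_iff_iteratedDeriv_eq_zero (hBA.mul hpA)).mp hord i hi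
      have h3 := hev.iteratedDeriv_eq i
      have h4 : iteratedDeriv i (fun w ↦ w ^ k - (blaschkeProd a m * p) w) z =
          iteratedDeriv i (fun w ↦ w ^ k) z := by
        have := iteratedDeriv_sub (n := i) (f := fun w : ℂ ↦ w ^ k) (g := blaschkeProd a m * p)
          (x := z) (by fun_prop) (hBA.mul hpA).contDiffAt
        rw [hvan, sub_zero] at this
        exact this
      rw [h4, iteratedDeriv_fun_sum fun j _ ↦ (analyticAt_const.fun_mul (hEA j)).contDiffAt] at h3
      simp_rw [iteratedDeriv_const_mul_field] at h3
      rw [← h3, Finset.mul_sum]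
      exact Finset.sum_congr rfl fun j _ ↦ by ring
    exact h2.unique (hasSum_iteratedDeriv hf (by linarith) i)
  · intro z hz
    have hcl : DiffContOnCl ℂ g (ball 0 1) :=
      DifferentiableOn.diffContOnCl_ball (U := ball 0 (2 - r)) hgd
        (closedBall_subset_ball (by linarith))
    refine Complex.norm_le_of_forall_mem_frontier_norm_le isBounded_ball hcl ?_
      (subset_closure hz)
    intro z hz
    have hz1 : ‖z‖ = 1 := by
      rw [frontier_ball _ one_ne_zero] at hz
      simpa using hz
    have h := pairing_le hα hfN ht0 (by linarith) htR
      (differentiableOn_modelKernel hr hr1 ha m z)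
      (circleAverage_normSq_modelKernel_le hr hr1 hn hσn ha hz1)
    rw [← (hgs z).tsum_eq]
    exact (norm_tsum_le_tsum_norm h.1).trans h.2

/-! ### Powers of Hardy space functions in weighted spaces -/

/-- If `∑ |ĥ(k)|² = X`, then `|(h ^ (m + 1))^(k)|² ≤ (k + 1) ^ m S k` for a sequence `S` with
`∑ S k = X ^ (m + 1)`: by induction, with the Cauchy-Schwarz inequality in the convolution. -/
lemma exists_hasSum_taylorCoeff_pow_le {h : ℂ → ℂ} (hh : AnalyticAt ℂ h 0) {X : ℝ}
    (hX : HasSum (fun k ↦ ‖taylorCoeff h k‖ ^ 2) X) (m : ℕ) :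
    ∃ S : ℕ → ℝ, (∀ k, 0 ≤ S k) ∧ HasSum S (X ^ (m + 1)) ∧
      ∀ k, ‖taylorCoeff (fun z ↦ h z ^ (m + 1)) k‖ ^ 2 ≤ ((k : ℝ) + 1) ^ m * S k := by
  induction m with
  | zero => exact ⟨fun k ↦ ‖taylorCoeff h k‖ ^ 2, fun k ↦ by positivity, by simpa using hX,
      fun k ↦ by simp⟩
  | succ m ih =>
    obtain ⟨S, hS0, hS, hle⟩ := ih
    have hSn : Summable fun k ↦ ‖S k‖ := hS.summable.norm
    have hXn : Summable fun k ↦ ‖‖taylorCoeff h k‖ ^ 2‖ := hX.summable.norm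
    refine ⟨fun n ↦ ∑ i ∈ Finset.range (n + 1), S i * ‖taylorCoeff h (n - i)‖ ^ 2,
      fun n ↦ Finset.sum_nonneg fun i _ ↦ mul_nonneg (hS0 i) (by positivity), ?_, fun n ↦ ?_⟩
    · have h1 := (summable_norm_sum_mul_range_of_summable_norm hSn hXn).of_norm.hasSum
      rwa [← tsum_mul_tsum_eq_tsum_sum_range_of_summable_norm hSn hXn, hS.tsum_eq, hX.tsum_eq,
        ← pow_succ] at h1
    · have h1 : (fun z ↦ h z ^ (m + 1 + 1)) = fun z ↦ h z ^ (m + 1) * h z := by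
        ext z; rw [pow_succ]
      rw [h1, taylorCoeff_mul (hh.fun_pow _) hh]
      calc ‖∑ i ∈ Finset.range (n + 1),
            taylorCoeff (fun z ↦ h z ^ (m + 1)) i * taylorCoeff h (n - i)‖ ^ 2
          ≤ (∑ i ∈ Finset.range (n + 1),
            ‖taylorCoeff (fun z ↦ h z ^ (m + 1)) i‖ * ‖taylorCoeff h (n - i)‖) ^ 2 := by
            gcongr
            exact (norm_sum_le _ _).trans (Finset.sum_le_sum fun i _ ↦ (norm_mul _ _).le)
        _ ≤ (n + 1) * ∑ i ∈ Finset.range (n + 1),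
            (‖taylorCoeff (fun z ↦ h z ^ (m + 1)) i‖ * ‖taylorCoeff h (n - i)‖) ^ 2 := by
            simpa using sq_sum_le_card_mul_sum_sq (s := Finset.range (n + 1)) (f := fun i ↦
              ‖taylorCoeff (fun z ↦ h z ^ (m + 1)) i‖ * ‖taylorCoeff h (n - i)‖)
        _ ≤ (n + 1) * ∑ i ∈ Finset.range (n + 1),
            ((n : ℝ) + 1) ^ m * (S i * ‖taylorCoeff h (n - i)‖ ^ 2) := by
            gcongr with i hi
            have hin : (i : ℝ) ≤ n := by
              exact_mod_cast Nat.lt_succ_iff.mp (Finset.mem_range.mp hi)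
            rw [mul_pow, ← mul_assoc]
            gcongr
            refine (hle i).trans ?_
            have := hS0 i
            gcongr
        _ = _ := by rw [← Finset.mul_sum, pow_succ]; ring

lemma normLa2_le {α : ℝ} {f : ℂ → ℂ} {S : ℕ → ℝ} {Y : ℝ} (hS : HasSum S Y)
    (hle : ∀ k, ‖taylorCoeff f k‖ ^ 2 * ((k : ℝ) + 1) ^ (2 * α) ≤ S k) :
    normLa2 α f ≤ ENNReal.ofReal (√Y) := by
  have hS0 : ∀ k, 0 ≤ S k := fun k ↦ le_trans (by positivity) (hle k)
  rw [Real.sqrt_eq_rpow, ← ENNReal.ofReal_rpow_of_nonneg (hS.nonneg hS0) (by norm_num), normLa2,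
    ← hS.tsum_eq, ENNReal.ofReal_tsum_of_nonneg hS0 hS.summable]
  gcongr with k
  calc ‖taylorCoeff f k‖ₑ ^ 2 * ENNReal.ofReal (((k : ℝ) + 1) ^ (2 * α))
      = ENNReal.ofReal (‖taylorCoeff f k‖ ^ 2 * ((k : ℝ) + 1) ^ (2 * α)) := by
        rw [ENNReal.ofReal_mul (by positivity), ENNReal.ofReal_pow (norm_nonneg _), ofReal_norm]
    _ ≤ _ := ENNReal.ofReal_le_ofReal (hle k)

/-- The power `m + 1` maps `H²` into `l_a^2(-m / 2)`, with `‖h ^ (m + 1)‖ ≤ ‖h‖ ^ (m + 1)`. -/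
lemma normLa2_const_mul_pow_le {h : ℂ → ℂ} (hh : AnalyticAt ℂ h 0) {X : ℝ}
    (hX : HasSum (fun k ↦ ‖taylorCoeff h k‖ ^ 2) X) (m : ℕ) (c : ℂ) {α : ℝ}
    (hα : 1 - 2 * α = ((m + 1 : ℕ) : ℝ)) :
    normLa2 α (fun z ↦ c * h z ^ (m + 1)) ≤ ENNReal.ofReal (‖c‖ * √(X ^ (m + 1))) := by
  obtain ⟨S, hS0, hS, hle⟩ := exists_hasSum_taylorCoeff_pow_le hh hX m
  have h1 : ‖c‖ * √(X ^ (m + 1)) = √(‖c‖ ^ 2 * X ^ (m + 1)) := by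
    rw [Real.sqrt_mul (by positivity), Real.sqrt_sq (norm_nonneg _)]
  rw [h1]
  refine normLa2_le (hS.mul_left (‖c‖ ^ 2)) fun k ↦ ?_
  have h2 : 2 * α = -(m : ℝ) := by push_cast at hα; linarith
  rw [taylorCoeff_const_mul, norm_mul, mul_pow, mul_assoc, h2, Real.rpow_neg (by positivity),
    Real.rpow_natCast, ← div_eq_mul_inv]
  gcongr
  rw [div_le_iff₀ (by positivity), mul_comm]
  exact hle k

/-! ### Coefficient sums of bounded functions -/

lemma taylorCoeff_aeval (P : Polynomial ℝ) (k : ℕ) :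
    taylorCoeff (fun z ↦ Polynomial.aeval z P) k = P.coeff k := by
  simp_rw [Polynomial.aeval_eq_sum_range]
  rw [taylorCoeff_sum _ fun i _ ↦ by fun_prop]
  have h : ∀ i, taylorCoeff (fun z : ℂ ↦ P.coeff i • z ^ i) k =
      if i = k then (P.coeff k : ℂ) else 0 := by
    intro i
    simp_rw [Complex.real_smul]
    rw [taylorCoeff_const_mul, taylorCoeff, iteratedDeriv_fun_pow_zero]
    have : (k.factorial : ℂ) ≠ 0 := by exact_mod_cast Nat.factorial_ne_zero k
    rcases eq_or_ne i k with rfl | hik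
    · simp [this]
    · simp [hik, hik.symm]
  simp_rw [h]
  rw [Finset.sum_ite_eq']
  split_ifs with h1
  · rfl
  · rw [Polynomial.coeff_eq_zero_of_natDegree_lt (by simpa [Nat.lt_succ_iff] using h1)]
    simp

/-- The geometric sum `1 + X + ⋯ + X ^ (p - 1)`. -/
noncomputable def geomPoly (p : ℕ) : Polynomial ℝ := ∑ k ∈ Finset.range p, Polynomial.X ^ k

lemma aeval_geomPoly (p : ℕ) (z : ℂ) :
    Polynomial.aeval z (geomPoly p) = ∑ k ∈ Finset.range p, z ^ k := by
  simp [geomPoly]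

/-- A Fejér type inequality: if `G` is bounded by `M`, the partial sums of order `n` of the Taylor
coefficients of `G (1 + z + ⋯ + z ^ (p - 1))` are at most `M √(n p)`. -/
lemma norm_sum_taylorCoeff_mul_geomPoly_le {G : ℂ → ℂ} (hG : DifferentiableOn ℂ G (ball 0 1))
    {M : ℝ} (hGM : ∀ z ∈ ball (0 : ℂ) 1, ‖G z‖ ≤ M) (n p : ℕ) :
    ‖∑ k ∈ Finset.range n, taylorCoeff (fun z ↦ G z * Polynomial.aeval z (geomPoly p)) k‖ ^ 2 ≤
      n * (M ^ 2 * p) := by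
  set H : ℂ → ℂ := fun z ↦ G z * Polynomial.aeval z (geomPoly p) with hH
  have hDd : Differentiable ℂ fun z : ℂ ↦ ∑ k ∈ Finset.range p, z ^ k := by fun_prop
  have hHd : DifferentiableOn ℂ H (ball 0 1) := by
    simp_rw [hH, aeval_geomPoly]
    exact hG.mul hDd.differentiableOn
  have key : ∑ k ∈ Finset.range n, ‖taylorCoeff H k‖ ^ 2 * (1 : ℝ) ^ (2 * k) ≤ M ^ 2 * p := by
    have hc : Continuous fun ρ : ℝ ↦ ∑ k ∈ Finset.range n, ‖taylorCoeff H k‖ ^ 2 * ρ ^ (2 * k) := by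
      fun_prop
    refine le_of_tendsto ((hc.tendsto 1).mono_left (nhdsWithin_le_nhds (s := Set.Iio 1))) ?_
    filter_upwards [Ioo_mem_nhdsLT (show (0 : ℝ) < 1 by norm_num)] with ρ hρ
    obtain ⟨hρ0, hρ1⟩ := hρ
    have h1 := hasSum_normSq_taylorCoeff hHd hρ0 hρ1
    have hsph : ∀ z ∈ sphere (0 : ℂ) |ρ|, z ∈ ball (0 : ℂ) 1 := by
      intro z hz
      have : ‖z‖ = ρ := by simpa [abs_of_pos hρ0] using hz
      simpa [this] using hρ1
    calc ∑ k ∈ Finset.range n, ‖taylorCoeff H k‖ ^ 2 * ρ ^ (2 * k)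
        ≤ Real.circleAverage (fun z ↦ ‖H z‖ ^ 2) 0 ρ :=
          sum_le_hasSum _ (fun k _ ↦ by positivity) h1
      _ ≤ Real.circleAverage
            (fun z ↦ M ^ 2 • ‖∑ k ∈ Finset.range p, (1 : ℂ) * z ^ k‖ ^ 2) 0 ρ := by
          refine Real.circleAverage_mono ?_ ?_ fun z hz ↦ ?_
          · exact ((hHd.continuousOn.mono hsph).norm.pow 2).circleIntegrable'
          · exact ContinuousOn.circleIntegrable' (by fun_prop)
          · simp only [hH, aeval_geomPoly, norm_mul, mul_pow, one_mul, smul_eq_mul]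
            gcongr
            exact hGM z (hsph z hz)
      _ = M ^ 2 * ∑ k ∈ Finset.range p, ρ ^ (2 * k) := by
          rw [Real.circleAverage_fun_smul, circleAverage_normSq_sum _ hρ0]
          simp
      _ ≤ M ^ 2 * p := by
          gcongr
          calc ∑ k ∈ Finset.range p, ρ ^ (2 * k) ≤ ∑ k ∈ Finset.range p, (1 : ℝ) :=
                Finset.sum_le_sum fun k _ ↦ pow_le_one₀ hρ0.le hρ1.le
            _ = p := by simp
  calc ‖∑ k ∈ Finset.range n, taylorCoeff H k‖ ^ 2
      ≤ (∑ k ∈ Finset.range n, ‖taylorCoeff H k‖) ^ 2 := by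
        gcongr
        exact norm_sum_le _ _
    _ ≤ n * ∑ k ∈ Finset.range n, ‖taylorCoeff H k‖ ^ 2 := by
        simpa using sq_sum_le_card_mul_sum_sq (s := Finset.range n) (f := fun k ↦ ‖taylorCoeff H k‖)
    _ ≤ n * (M ^ 2 * p) := by
        gcongr
        simpa using key

open Polynomial in
lemma coeff_geomPoly_pow_nonneg (p m k : ℕ) : 0 ≤ (geomPoly p ^ m).coeff k := by
  induction m generalizing k with
  | zero => rw [pow_zero, coeff_one]; split_ifs <;> norm_num
  | succ m ih =>
    rw [pow_succ, coeff_mul]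
    refine Finset.sum_nonneg fun x _ ↦ mul_nonneg (ih _) ?_
    rw [geomPoly, finsetSum_coeff]
    refine Finset.sum_nonneg fun i _ ↦ ?_
    rw [coeff_X_pow]
    split_ifs <;> norm_num

open Polynomial in
lemma coeff_le_coeff_one_add_mul_X_pow_mul {a : ℝ} (ha : 0 ≤ a) {Q : Polynomial ℝ}
    (hQ : ∀ k, 0 ≤ Q.coeff k) (m k : ℕ) : Q.coeff k ≤ ((1 + C a * X) ^ m * Q).coeff k := by
  induction m generalizing k with
  | zero => simp
  | succ m ih =>
    have h1 : (1 + C a * X) ^ (m + 1) * Q =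
        (1 + C a * X) ^ m * Q + C a * (X * ((1 + C a * X) ^ m * Q)) := by ring
    rw [h1, coeff_add, coeff_C_mul]
    have h2 : 0 ≤ (X * ((1 + C a * X) ^ m * Q)).coeff k := by
      rcases k with _ | k
      · simp
      · rw [coeff_X_mul]
        exact (hQ k).trans (ih k)
    have := ih k
    have := mul_nonneg ha h2
    linarith

open Polynomial in
lemma pow_le_sum_coeff {a : ℝ} (ha : 0 ≤ a) {n p m N : ℕ} (hp : 1 ≤ p) (h : (p - 1) * m < n) :
    (p : ℝ) ^ m ≤ ∑ k ∈ Finset.range n, ((1 + C a * X) ^ N * geomPoly p ^ m).coeff k := by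
  have hdeg : (geomPoly p ^ m).natDegree < n := by
    refine lt_of_le_of_lt ?_ h
    refine natDegree_pow_le.trans ?_
    rw [mul_comm]
    gcongr
    refine natDegree_sum_le_of_forall_le _ _ fun i hi ↦ ?_
    have := Finset.mem_range.mp hi
    rw [natDegree_X_pow]
    omega
  have h1 : (geomPoly p ^ m).eval 1 = (p : ℝ) ^ m := by
    rw [eval_pow, geomPoly, eval_finsetSum]
    simp
  rw [← h1, eval_eq_sum_range' hdeg]
  refine Finset.sum_le_sum fun k _ ↦ ?_
  rw [one_pow, mul_one]
  exact coeff_le_coeff_one_add_mul_X_pow_mul ha (coeff_geomPoly_pow_nonneg p m) N k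

/-! ### Extremal functions for a single point -/

lemma norm_blaschke_lt_one {a z : ℂ} (ha : ‖a‖ < 1) (hz : ‖z‖ < 1) : ‖blaschke a z‖ < 1 := by
  have key := normSq_sub_sub_normSq a z
  have h1 : 0 < 1 - ‖z‖ ^ 2 := sub_pos.mpr (pow_lt_one₀ (norm_nonneg z) hz two_ne_zero)
  have h2 : 0 < 1 - ‖a‖ ^ 2 := sub_pos.mpr (pow_lt_one₀ (norm_nonneg a) ha two_ne_zero)
  have h3 : ‖z - a‖ < ‖1 - conj a * z‖ := by
    refine lt_of_pow_lt_pow_left₀ 2 (norm_nonneg _) ?_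
    nlinarith [mul_pos h1 h2]
  rw [blaschke, norm_div]
  exact (div_lt_one ((norm_nonneg _).trans_lt h3)).mpr h3

lemma norm_one_sub_conj_mul {a z : ℂ} (hz : ‖z‖ = 1) : ‖1 - conj a * z‖ = ‖z - a‖ := by
  have key := normSq_sub_sub_normSq a z
  rw [hz, one_pow, sub_self, zero_mul, sub_eq_zero] at key
  exact ((pow_left_inj₀ (norm_nonneg _) (norm_nonneg _) two_ne_zero).mp key).symm

/-- The sum of the first `p` elements of the orthogonal system `b ^ k / (1 - conj lam z)`, where `b`
is the Blaschke factor of `lam` rotated by `conj ζ`. -/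
noncomputable def modelSum (lam ζ : ℂ) (p : ℕ) (z : ℂ) : ℂ :=
  (∑ k ∈ Finset.range p, (conj ζ * blaschke lam z) ^ k) / (1 - conj lam * z)

lemma differentiableOn_modelSum {lam : ℂ} (hlam : ‖lam‖ < 1) (ζ : ℂ) (p : ℕ) :
    DifferentiableOn ℂ (modelSum lam ζ p) (ball 0 (2 - ‖lam‖)) := by
  have hb := differentiableOn_blaschke (norm_nonneg lam) hlam le_rfl
  refine DifferentiableOn.div
    (DifferentiableOn.fun_sum fun k _ ↦ (hb.const_mul _).pow k) (by fun_prop) fun z hz ↦ ?_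
  exact one_sub_mul_ne_zero (norm_nonneg lam) hlam (by simp) (by simpa using hz)

lemma hasSum_normSq_taylorCoeff_modelSum {lam ζ : ℂ} (hlam : ‖lam‖ < 1) (hζ : ‖ζ‖ = 1) (p : ℕ) :
    HasSum (fun k ↦ ‖taylorCoeff (modelSum lam ζ p) k‖ ^ 2) (p / (1 - ‖lam‖ ^ 2)) := by
  have hd : 0 < 1 - ‖lam‖ ^ 2 := sub_pos.mpr (pow_lt_one₀ (norm_nonneg _) hlam two_ne_zero)
  have h := hasSum_normSq_taylorCoeff (differentiableOn_modelSum hlam ζ p) one_pos (by linarith)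
  have hb := differentiableOn_blaschke (norm_nonneg lam) hlam le_rfl
  have hbc : DiffContOnCl ℂ (fun z ↦ conj ζ * blaschke lam z) (ball 0 1) :=
    DifferentiableOn.diffContOnCl_ball (U := ball 0 (2 - ‖lam‖)) (hb.const_mul _)
      (closedBall_subset_ball (by linarith))
  have hne : ∀ z : ℂ, ‖z‖ = 1 → z - lam ≠ 0 := by
    intro z hz h0
    rw [sub_eq_zero.mp h0] at hz
    exact hlam.ne hz
  have h1 := circleAverage_poissonKernel_mul_normSq_sum (fun _ ↦ 1) (s := 1) hlam hbc
    (fun z hz ↦ by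
      rw [norm_mul, RCLike.norm_conj, hζ, one_mul, blaschke, norm_div, norm_one_sub_conj_mul hz,
        div_self (norm_ne_zero_iff.mpr (hne z hz))])
    (by simp [blaschke]) p
  have h2 : Set.EqOn (fun z ↦ ‖modelSum lam ζ p z‖ ^ 2)
      (fun z ↦ (1 - ‖lam‖ ^ 2)⁻¹ • (poissonKernel 0 lam z *
        ‖∑ k ∈ Finset.range p, 1 * (conj ζ * blaschke lam z) ^ k‖ ^ 2)) (sphere 0 |1|) := by
    intro z hz
    have hz' : ‖z‖ = 1 := by simpa using hz
    have := norm_ne_zero_iff.mpr (hne z hz')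
    simp only [modelSum, norm_div, norm_one_sub_conj_mul hz', poissonKernel_def, sub_zero, hz',
      one_mul, smul_eq_mul]
    field_simp
  rw [Real.circleAverage_congr_sphere h2, Real.circleAverage_fun_smul, h1] at h
  simpa [div_eq_inv_mul] using h

/-- The automorphism of the disc that takes `0` to `lam = |lam| ζ` turns `modelSum` into a geometric
sum with a positive factor. -/
lemma modelSum_comp {a : ℝ} (ha : 0 ≤ a) (ha1 : a < 1) {ζ : ℂ} (hζ : ‖ζ‖ = 1) (p : ℕ) {u : ℂ}
    (hu : ‖u‖ < 1) :
    modelSum (a * ζ) ζ p (ζ * blaschke (-(a : ℂ)) u) =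
      ((1 + a * u) / (1 - (a : ℂ) ^ 2)) * ∑ k ∈ Finset.range p, u ^ k := by
  have hζc : conj ζ * ζ = 1 := by rw [Complex.conj_mul', hζ]; simp
  have h1 : 1 + a * u ≠ 0 := by
    have := one_sub_mul_ne_zero ha ha1 (a := -(a : ℂ)) (z := u) (by simp [abs_of_nonneg ha])
      (by linarith)
    simpa using this
  have h2 : (1 : ℂ) - (a : ℂ) ^ 2 ≠ 0 := by
    rw [← Complex.ofReal_pow, ← Complex.ofReal_one, ← Complex.ofReal_sub, Complex.ofReal_ne_zero]
    nlinarith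
  have hv : blaschke (-(a : ℂ)) u = (u + a) / (1 + a * u) := by simp [blaschke]
  set v := blaschke (-(a : ℂ)) u with hv'
  have h3 : 1 - conj (a * ζ) * (ζ * v) = (1 - (a : ℂ) ^ 2) / (1 + a * u) := by
    have : conj (a * ζ) * (ζ * v) = a * v := by
      rw [map_mul, Complex.conj_ofReal]
      linear_combination (a * v : ℂ) * hζc
    rw [this, hv]
    field_simp
    ring
  have h4 : conj ζ * blaschke (a * ζ) (ζ * v) = u := by
    rw [blaschke, h3, ← mul_div_assoc]
    have : conj ζ * (ζ * v - a * ζ) = v - a := by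
      linear_combination (v - a : ℂ) * hζc
    have hva : v - a = u * ((1 - (a : ℂ) ^ 2) / (1 + a * u)) := by
      rw [hv, div_sub' h1, ← mul_div_assoc]
      congr 1
      ring
    rw [this, hva, mul_div_cancel_right₀ _ (div_ne_zero h2 h1)]
  rw [modelSum, h3, h4]
  field_simp

/-- A function in the ball of radius `t` of `l_a^2(α)`, all of whose interpolants of order `n` at
`lam` are large: a multiple of the power `m + 1` of a sum of `p` elements of an orthogonal basis of
the model space, with `p` comparable to `n`. -/
theorem exists_extremal {m : ℕ} {α : ℝ} (hα : 1 - 2 * α = ((m + 1 : ℕ) : ℝ)) {n : ℕ} (hn : 1 ≤ n)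
    {lam : ℂ} (hlam : ‖lam‖ < 1) {t : ℝ} (ht : 0 ≤ t) :
    ∃ f ∈ Hol, normLa2 α f ≤ ENNReal.ofReal t ∧ ∀ g ∈ Hol, SameTrace (onePoint n lam) g f →
      ∀ M : ℝ, (∀ z ∈ ball (0 : ℂ) 1, ‖g z‖ ≤ M) →
        t * √((n / (1 - ‖lam‖) / (2 * (m + 2))) ^ (m + 1) / (m + 2)) ≤ M := by
  set a : ℝ := ‖lam‖ with ha
  have ha0 : 0 ≤ a := norm_nonneg _
  set ζ : ℂ := Complex.exp (lam.arg * Complex.I) with hζdef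
  have hζ : ‖ζ‖ = 1 := Complex.norm_exp_ofReal_mul_I _
  have hlamζ : lam = a * ζ := (Complex.norm_mul_exp_arg_mul_I lam).symm
  obtain ⟨p, hp, hpn, hnp⟩ : ∃ p : ℕ, 1 ≤ p ∧ (p - 1) * (m + 2) < n ∧ n ≤ p * (m + 2) := by
    refine ⟨(n - 1) / (m + 2) + 1, Nat.le_add_left _ _, ?_, ?_⟩
    · have := Nat.div_mul_le_self (n - 1) (m + 2)
      rw [Nat.add_sub_cancel]
      omega
    · have := Nat.lt_mul_div_succ (n - 1) (show 0 < m + 2 by omega)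
      rw [mul_comm]
      omega
  have hp0 : (0 : ℝ) < p := by exact_mod_cast hp
  have hd : 0 < 1 - a ^ 2 := sub_pos.mpr (pow_lt_one₀ ha0 hlam two_ne_zero)
  set X : ℝ := p / (1 - a ^ 2) with hX
  have hX0 : 0 < X := by positivity
  have hsq0 : 0 < √(X ^ (m + 1)) := Real.sqrt_pos.mpr (by positivity)
  set h : ℂ → ℂ := modelSum lam ζ p with hh
  set c : ℝ := t / √(X ^ (m + 1)) with hc
  have hhd : DifferentiableOn ℂ h (ball 0 (2 - a)) := differentiableOn_modelSum hlam ζ p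
  have hhA : AnalyticAt ℂ h 0 :=
    analyticAt_of_differentiableOn_ball hhd (by rw [norm_zero]; linarith)
  set f : ℂ → ℂ := fun z ↦ c * h z ^ (m + 1) with hf
  have hfd : DifferentiableOn ℂ f (ball 0 1) :=
    ((hhd.pow (m + 1)).const_mul _).mono (ball_subset_ball (by linarith))
  refine ⟨f, hfd, ?_, ?_⟩
  · refine (normLa2_const_mul_pow_le hhA (hasSum_normSq_taylorCoeff_modelSum hlam hζ p) m c
      hα).trans (ENNReal.ofReal_le_ofReal (le_of_eq ?_))
    rw [Complex.norm_real, Real.norm_of_nonneg (by positivity), hc, div_mul_cancel₀ _ hsq0.ne']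
  intro g hg hgf M hM
  have hM0 : 0 ≤ M := (norm_nonneg _).trans (hM 0 (by simp))
  set φ : ℂ → ℂ := fun u ↦ ζ * blaschke (-(a : ℂ)) u with hφ
  have hna : ‖-(a : ℂ)‖ = a := by simp [abs_of_nonneg ha0]
  have hφd : DifferentiableOn ℂ φ (ball 0 1) :=
    ((differentiableOn_blaschke ha0 hlam hna.le).const_mul _).mono
      (ball_subset_ball (by linarith))
  have hφmaps : Set.MapsTo φ (ball 0 1) (ball 0 1) := by
    intro u hu
    have := norm_blaschke_lt_one (a := -(a : ℂ)) (z := u) (by rw [hna]; exact hlam)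
      (by simpa using hu)
    simpa [hφ, hζ] using this
  have hφ0 : φ 0 = lam := by simp [hφ, blaschke, hlamζ, mul_comm]
  have h01 : ‖(0 : ℂ)‖ < 1 := by simp
  have hGd : DifferentiableOn ℂ (g ∘ φ) (ball 0 1) := hg.comp hφd hφmaps
  have hFd : DifferentiableOn ℂ (f ∘ φ) (ball 0 1) := hfd.comp hφd hφmaps
  have hgA : AnalyticAt ℂ g lam := analyticAt_of_differentiableOn_ball hg hlam
  have hfA : AnalyticAt ℂ f lam := analyticAt_of_differentiableOn_ball hfd hlam
  have hφA : AnalyticAt ℂ φ 0 := analyticAt_of_differentiableOn_ball hφd h01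
  have hGA : AnalyticAt ℂ (g ∘ φ) 0 := analyticAt_of_differentiableOn_ball hGd h01
  have hFA : AnalyticAt ℂ (f ∘ φ) 0 := analyticAt_of_differentiableOn_ball hFd h01
  set D : ℂ → ℂ := fun u ↦ Polynomial.aeval u (geomPoly p) with hD
  have hDA : AnalyticAt ℂ D 0 := by
    have : D = fun u ↦ ∑ k ∈ Finset.range p, u ^ k := funext fun u ↦ aeval_geomPoly p u
    rw [this]
    fun_prop
  -- The functions `g ∘ φ` and `f ∘ φ` agree to the order `n` at the origin.
  have hord : (n : ℕ∞) ≤ analyticOrderAt ((g - f) ∘ φ) 0 := by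
    have h1 : (n : ℕ∞) ≤ analyticOrderAt (g - f) (φ 0) := by
      rw [hφ0, natCast_le_analyticOrderAt_iff_iteratedDeriv_eq_zero (hgA.sub hfA)]
      intro i hi
      have h2 := hgf lam (by simp [onePoint, Multiset.mem_replicate]; omega) i
        (by simpa [onePoint] using hi)
      rw [iteratedDeriv_sub hgA.contDiffAt hfA.contDiffAt, h2, sub_self]
    have hgfA : AnalyticAt ℂ (g - f) (φ 0) := by rw [hφ0]; exact hgA.sub hfA
    rw [hgfA.analyticOrderAt_comp hφA]
    have h3 : analyticOrderAt (fun u ↦ φ u - φ 0) 0 ≠ 0 :=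
      (hφA.fun_sub analyticAt_const).analyticOrderAt_ne_zero.mpr (sub_self _)
    calc (n : ℕ∞) = n * 1 := (mul_one _).symm
      _ ≤ _ := mul_le_mul' h1 (Order.one_le_iff_ne_zero.mpr h3)
  have hdA : AnalyticAt ℂ ((g - f) ∘ φ) 0 := hGA.sub hFA
  have hcoef : ∀ k < n, taylorCoeff (fun u ↦ (g ∘ φ) u * D u) k =
      taylorCoeff (fun u ↦ (f ∘ φ) u * D u) k := by
    intro k hk
    have h1 : (n : ℕ∞) ≤ analyticOrderAt (((g - f) ∘ φ) * D) 0 := by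
      rw [analyticOrderAt_mul hdA hDA]
      exact le_add_right hord
    have h2 := (natCast_le_analyticOrderAt_iff_iteratedDeriv_eq_zero
      (hdA.mul hDA)).mp h1 k hk
    have h3 : ((g - f) ∘ φ) * D = (fun u ↦ (g ∘ φ) u * D u) - fun u ↦ (f ∘ φ) u * D u := by
      ext u
      simp [sub_mul]
    rw [h3, iteratedDeriv_sub (hGA.fun_mul hDA).contDiffAt (hFA.fun_mul hDA).contDiffAt,
      sub_eq_zero] at h2
    rw [taylorCoeff, taylorCoeff, h2]
  -- The function `(f ∘ φ) D` is a polynomial with nonnegative coefficients.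
  set P : Polynomial ℝ := (1 + Polynomial.C a * Polynomial.X) ^ (m + 1) * geomPoly p ^ (m + 2)
    with hP
  set K : ℝ := c / (1 - a ^ 2) ^ (m + 1) with hK
  have hK0 : 0 ≤ K := by positivity
  have hFD : ∀ k, taylorCoeff (fun u ↦ (f ∘ φ) u * D u) k = ((K * P.coeff k : ℝ) : ℂ) := by
    intro k
    have h1 : (fun u ↦ (f ∘ φ) u * D u) =ᶠ[𝓝 0] fun u ↦ (K : ℂ) * Polynomial.aeval u P := by
      filter_upwards [isOpen_ball.mem_nhds (show (0 : ℂ) ∈ ball 0 1 by simp)] with u hu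
      have h2 := modelSum_comp ha0 hlam hζ p (u := u) (by simpa using hu)
      rw [← hlamζ] at h2
      have h3 : h (φ u) = _ := h2
      simp only [Function.comp_apply, hf, h3, hD, hP, hK, map_mul, map_pow, map_add, map_one,
        Polynomial.aeval_C, Polynomial.aeval_X, aeval_geomPoly, Complex.coe_algebraMap]
      push_cast
      rw [mul_pow, div_pow]
      ring
    have h2 : taylorCoeff (fun u ↦ (f ∘ φ) u * D u) k = _ :=
      congrArg (· / (k.factorial : ℂ)) (h1.iteratedDeriv_eq k)
    rw [h2]
    refine (taylorCoeff_const_mul _ _ k).trans ?_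
    rw [taylorCoeff_aeval]
    push_cast
    rfl
  have hsum : K * p ^ (m + 2) ≤
      ‖∑ k ∈ Finset.range n, taylorCoeff (fun u ↦ (g ∘ φ) u * D u) k‖ := by
    have h1 : ∑ k ∈ Finset.range n, taylorCoeff (fun u ↦ (g ∘ φ) u * D u) k =
        ((K * ∑ k ∈ Finset.range n, P.coeff k : ℝ) : ℂ) := by
      rw [Finset.mul_sum, Complex.ofReal_sum]
      exact Finset.sum_congr rfl fun k hk ↦ by rw [hcoef k (Finset.mem_range.mp hk), hFD k]
    rw [h1, Complex.norm_real]
    refine le_trans ?_ (le_abs_self _)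
    gcongr
    exact pow_le_sum_coeff ha0 hp hpn
  have hfejer := norm_sum_taylorCoeff_mul_geomPoly_le hGd
    (fun z hz ↦ hM (φ z) (hφmaps hz)) n p
  have hmain : (K * p ^ (m + 2)) ^ 2 ≤ n * (M ^ 2 * p) :=
    (pow_le_pow_left₀ (by positivity) hsum 2).trans hfejer
  have hnp' : (n : ℝ) ≤ p * (m + 2) := by exact_mod_cast hnp
  -- Since `c ^ 2 = t ^ 2 / X ^ (m + 1)`, the left-hand side of `hmain` is
  -- `t ^ 2 X ^ (m + 1) p ^ 2`.
  have hlhs : (K * p ^ (m + 2)) ^ 2 = t ^ 2 * X ^ (m + 1) * p ^ 2 := by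
    have h1 : c ^ 2 = t ^ 2 / X ^ (m + 1) := by
      rw [hc, div_pow, Real.sq_sqrt (by positivity)]
    rw [hK, mul_pow, div_pow, h1, hX, div_pow]
    field_simp
    ring
  have h1 : t ^ 2 * X ^ (m + 1) ≤ (m + 2) * M ^ 2 := by
    rw [hlhs] at hmain
    have h2 : n * (M ^ 2 * p) ≤ (p * (m + 2)) * (M ^ 2 * p) := by gcongr
    have h3 : (t ^ 2 * X ^ (m + 1)) * p ^ 2 ≤ ((m + 2) * M ^ 2) * p ^ 2 := by
      calc _ ≤ _ := hmain.trans h2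
        _ = _ := by ring
    exact le_of_mul_le_mul_right h3 (by positivity)
  have hXle : n / (1 - a) / (2 * (m + 2)) ≤ X := by
    have h1a : 0 < 1 - a := sub_pos.mpr hlam
    rw [hX, div_div, div_le_div_iff₀ (by positivity) hd]
    calc n * (1 - a ^ 2) ≤ (p * (m + 2)) * (2 * (1 - a)) := by
          gcongr
          nlinarith
      _ = _ := by ring
  have h1a : 0 < 1 - a := sub_pos.mpr hlam
  refine abs_le_of_sq_le_sq' ?_ hM0 |>.2
  rw [mul_pow, Real.sq_sqrt (by positivity), ← mul_div_assoc, div_le_iff₀ (by positivity)]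
  calc t ^ 2 * (n / (1 - a) / (2 * (m + 2))) ^ (m + 1) ≤ t ^ 2 * X ^ (m + 1) := by gcongr
    _ ≤ _ := h1
    _ = _ := by ring

/-! ### Weighted Bergman spaces -/

lemma lintegral_normSq_circle {f : ℂ → ℂ} (hf : DifferentiableOn ℂ f (ball 0 1)) {ρ : ℝ}
    (hρ : 0 < ρ) (hρ1 : ρ < 1) :
    ∫⁻ θ in Set.Ioo (-Real.pi) Real.pi, ‖f (circleMap 0 ρ θ)‖ₑ ^ 2 =
      ENNReal.ofReal (2 * Real.pi) *
        ∑' k, ‖taylorCoeff f k‖ₑ ^ 2 * ENNReal.ofReal (ρ ^ (2 * k)) := by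
  have hpi := Real.pi_pos
  have hP := hasSum_normSq_taylorCoeff hf hρ hρ1
  have hcont : Continuous fun θ : ℝ ↦ ‖f (circleMap 0 ρ θ)‖ ^ 2 := by
    refine (hf.continuousOn.comp_continuous (by fun_prop) fun θ ↦ ?_).norm.pow 2
    simpa [abs_of_pos hρ] using hρ1
  have h1 : ∫ θ in Set.Ioo (-Real.pi) Real.pi, ‖f (circleMap 0 ρ θ)‖ ^ 2 =
      2 * Real.pi * Real.circleAverage (fun z ↦ ‖f z‖ ^ 2) 0 ρ := by
    rw [Real.circleAverage_eq_integral_add (-Real.pi),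
      intervalIntegral.integral_comp_add_right (fun θ ↦ ‖f (circleMap 0 ρ θ)‖ ^ 2),
      smul_eq_mul, mul_inv_cancel_left₀ (by positivity), ← integral_Ioc_eq_integral_Ioo,
      ← intervalIntegral.integral_of_le (by linarith)]
    congr 1 <;> ring
  have h2 : ∀ k, ‖taylorCoeff f k‖ₑ ^ 2 * ENNReal.ofReal (ρ ^ (2 * k)) =
      ENNReal.ofReal (‖taylorCoeff f k‖ ^ 2 * ρ ^ (2 * k)) := by
    intro k
    rw [ENNReal.ofReal_mul (by positivity), ENNReal.ofReal_pow (norm_nonneg _), ofReal_norm]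
  simp_rw [h2]
  rw [← ENNReal.ofReal_tsum_of_nonneg (fun k ↦ by positivity) hP.summable, hP.tsum_eq,
    ← ENNReal.ofReal_mul (by positivity), ← h1, ofReal_integral_eq_lintegral_ofReal]
  · refine lintegral_congr fun θ ↦ ?_
    rw [ENNReal.ofReal_pow (norm_nonneg _), ofReal_norm]
  · exact (hcont.integrableOn_Icc (a := -Real.pi) (b := Real.pi)).mono_set Set.Ioo_subset_Icc_self
  · exact Eventually.of_forall fun θ ↦ by positivity

lemma lintegral_radial_weight {β : ℝ} (hβ : -1 < β) (k : ℕ) :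
    ∫⁻ ρ in Set.Ioo (0 : ℝ) 1, ENNReal.ofReal (2 * ρ) *
      (ENNReal.ofReal ((1 - ρ ^ 2) ^ β) * ENNReal.ofReal (ρ ^ (2 * k))) =
    ENNReal.ofReal (ProbabilityTheory.beta (k + 1) (β + 1)) := by
  have hk : (0 : ℝ) < (k : ℝ) + 1 := by positivity
  have hb := ProbabilityTheory.beta_pos hk (show 0 < β + 1 by linarith)
  have himg : (fun x : ℝ ↦ x ^ 2) '' Set.Ioo 0 1 = Set.Ioo 0 1 := by
    ext y
    constructor
    · rintro ⟨x, ⟨hx0, hx1⟩, rfl⟩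
      exact ⟨by positivity, pow_lt_one₀ hx0.le hx1 two_ne_zero⟩
    · rintro ⟨hy0, hy1⟩
      exact ⟨√y, ⟨Real.sqrt_pos.mpr hy0, by rwa [Real.sqrt_lt' one_pos, one_pow]⟩,
        Real.sq_sqrt hy0.le⟩
  have hinj : Set.InjOn (fun x : ℝ ↦ x ^ 2) (Set.Ioo 0 1) := by
    intro x hx y hy hxy
    exact (pow_left_inj₀ hx.1.le hy.1.le two_ne_zero).mp hxy
  have h1 := ProbabilityTheory.lintegral_betaPDF_eq_one hk (show 0 < β + 1 by linarith)
  rw [ProbabilityTheory.lintegral_betaPDF, ← himg,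
    lintegral_image_eq_lintegral_abs_deriv_mul (f' := fun x ↦ 2 * x) measurableSet_Ioo
      (fun x _ ↦ by simpa using (hasDerivAt_pow 2 x).hasDerivWithinAt) hinj] at h1
  rw [← mul_one (ENNReal.ofReal (ProbabilityTheory.beta _ _)), ← h1,
    ← lintegral_const_mul' _ _ ENNReal.ofReal_ne_top]
  refine setLIntegral_congr_fun measurableSet_Ioo fun x hx ↦ ?_
  obtain ⟨hx0, hx1⟩ := hx
  have hx2 : 0 < 1 - x ^ 2 := sub_pos.mpr (pow_lt_one₀ hx0.le hx1 two_ne_zero)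
  have hr : 0 ≤ (1 - x ^ 2) ^ β := by positivity
  rw [← ENNReal.ofReal_mul hr, ← ENNReal.ofReal_mul (by positivity),
    ← ENNReal.ofReal_mul (by positivity), ← ENNReal.ofReal_mul hb.le]
  congr 1
  rw [abs_of_pos (by positivity), add_sub_cancel_right, add_sub_cancel_right, Real.rpow_natCast,
    ← pow_mul]
  field_simp

/-- The Bergman norm in terms of Taylor coefficients. -/
theorem normBergman_eq {β : ℝ} (hβ : -1 < β) {f : ℂ → ℂ} (hf : f ∈ Hol) :
    normBergman β f = (∑' k : ℕ, ‖taylorCoeff f k‖ₑ ^ 2 *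
      ENNReal.ofReal (ProbabilityTheory.beta (k + 1) (β + 1))) ^ (1 / 2 : ℝ) := by
  have hpi := Real.pi_pos
  rw [normBergman]
  congr 1
  set F : ℂ → ℂ := (ball (0 : ℂ) 1).indicator f with hF
  have hFm : Measurable F := by
    classical
    rw [hF, ← Set.piecewise_eq_indicator]
    exact hf.continuousOn.measurable_piecewise continuousOn_const measurableSet_ball
  set J : ℂ → ℝ≥0∞ := fun z ↦ ‖F z‖ₑ ^ 2 * ENNReal.ofReal ((1 - ‖z‖ ^ 2) ^ β) with hJ
  have hJm : Measurable J := by fun_prop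
  have h1 : ∫⁻ z in ball (0 : ℂ) 1, ‖f z‖ₑ ^ 2 * ENNReal.ofReal ((1 - ‖z‖ ^ 2) ^ β) =
      ∫⁻ z, J z := by
    rw [← lintegral_indicator measurableSet_ball]
    refine lintegral_congr fun z ↦ ?_
    by_cases hz : z ∈ ball (0 : ℂ) 1 <;> simp [hJ, hF, hz]
  have hpc : ∀ ρ θ : ℝ, Complex.polarCoord.symm (ρ, θ) = circleMap 0 ρ θ := by
    intro ρ θ
    simp [circleMap, Complex.exp_mul_I]
  have hcm : Measurable fun q : ℝ × ℝ ↦ circleMap 0 q.1 q.2 := by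
    simp only [circleMap]
    fun_prop
  have h2 : ∫⁻ z, J z = ∫⁻ ρ in Set.Ioi (0 : ℝ), ∫⁻ θ in Set.Ioo (-Real.pi) Real.pi,
      ENNReal.ofReal ρ * J (circleMap 0 ρ θ) := by
    rw [← Complex.lintegral_comp_polarCoord_symm, polarCoord_target, Measure.volume_eq_prod,
      ← Measure.prod_restrict, lintegral_prod]
    · simp_rw [hpc, smul_eq_mul]
    · refine Measurable.aemeasurable ?_
      have : (fun q : ℝ × ℝ ↦ ENNReal.ofReal q.1 • J (Complex.polarCoord.symm q)) =
          fun q ↦ ENNReal.ofReal q.1 * J (circleMap 0 q.1 q.2) := by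
        ext q
        rw [← hpc, smul_eq_mul]
      rw [this]
      exact (ENNReal.measurable_ofReal.comp measurable_fst).mul (hJm.comp hcm)
  have h3 : ∀ ρ ∈ Set.Ioi (0 : ℝ), ∫⁻ θ in Set.Ioo (-Real.pi) Real.pi,
      ENNReal.ofReal ρ * J (circleMap 0 ρ θ) = (Set.Ioo (0 : ℝ) 1).indicator (fun ρ ↦
        ENNReal.ofReal Real.pi * ∑' k, ‖taylorCoeff f k‖ₑ ^ 2 * (ENNReal.ofReal (2 * ρ) *
          (ENNReal.ofReal ((1 - ρ ^ 2) ^ β) * ENNReal.ofReal (ρ ^ (2 * k))))) ρ := by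
    intro ρ hρ
    have hρ0 : 0 < ρ := hρ
    by_cases hρ1 : ρ < 1
    · rw [Set.indicator_of_mem (show ρ ∈ Set.Ioo (0 : ℝ) 1 from ⟨hρ, hρ1⟩)]
      have h4 : ∀ θ, ENNReal.ofReal ρ * J (circleMap 0 ρ θ) =
          (ENNReal.ofReal ρ * ENNReal.ofReal ((1 - ρ ^ 2) ^ β)) *
            ‖f (circleMap 0 ρ θ)‖ₑ ^ 2 := by
        intro θ
        have : circleMap 0 ρ θ ∈ ball (0 : ℂ) 1 := by simpa [abs_of_pos hρ0] using hρ1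
        simp only [hJ, hF, Set.indicator_of_mem this, norm_circleMap_zero, sq_abs]
        ring
      simp_rw [h4]
      rw [lintegral_const_mul' _ _ (ENNReal.mul_ne_top ENNReal.ofReal_ne_top ENNReal.ofReal_ne_top),
        lintegral_normSq_circle hf hρ0 hρ1, ← mul_assoc, ← ENNReal.tsum_mul_left,
        ← ENNReal.tsum_mul_left]
      refine tsum_congr fun k ↦ ?_
      rw [ENNReal.ofReal_mul zero_le_two, ENNReal.ofReal_mul zero_le_two]
      ring
    · rw [Set.indicator_of_notMem (fun h ↦ hρ1 h.2)]
      have h4 : ∀ θ, ENNReal.ofReal ρ * J (circleMap 0 ρ θ) = 0 := by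
        intro θ
        have : circleMap 0 ρ θ ∉ ball (0 : ℂ) 1 := by simpa [abs_of_pos hρ0] using hρ1
        simp [hJ, hF, Set.indicator_of_notMem this]
      simp [h4]
  rw [h1, h2, setLIntegral_congr_fun measurableSet_Ioi h3, setLIntegral_indicator measurableSet_Ioo,
    Set.inter_eq_left.mpr Set.Ioo_subset_Ioi_self, lintegral_const_mul' _ _ ENNReal.ofReal_ne_top,
    ← mul_assoc, ← ENNReal.ofReal_mul (by positivity), inv_mul_cancel₀ hpi.ne', ENNReal.ofReal_one,
    one_mul, lintegral_tsum]
  · refine tsum_congr fun k ↦ ?_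
    rw [lintegral_const_mul, lintegral_radial_weight hβ]
    fun_prop
  · intro k
    fun_prop

lemma tendsto_beta_mul_rpow {s : ℝ} (hs : 0 < s) :
    Tendsto (fun k : ℕ ↦ ProbabilityTheory.beta (k + 1) s * ((k : ℝ) + 1) ^ s) atTop
      (𝓝 (Real.Gamma s)) := by
  have hprod : ∀ m : ℕ, Real.Gamma (s + m) = (∏ j ∈ Finset.range m, (s + j)) * Real.Gamma s := by
    intro m
    induction m with
    | zero => simp
    | succ m ih =>
      rw [Finset.prod_range_succ, Nat.cast_succ, ← add_assoc, Real.Gamma_add_one (by positivity),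
        ih]
      ring
  have heq : ∀ k : ℕ, ProbabilityTheory.beta (k + 1) s * ((k : ℝ) + 1) ^ s =
      Real.GammaSeq s (k + 1) * (1 + s / ((k + 1 : ℕ) : ℝ)) := by
    intro k
    have hG := Real.Gamma_pos_of_pos hs
    have hprod0 : 0 < ∏ j ∈ Finset.range (k + 1), (s + (j : ℝ)) :=
      Finset.prod_pos fun j _ ↦ by positivity
    have h1 := hprod (k + 1)
    rw [ProbabilityTheory.beta, Real.Gamma_nat_eq_factorial, Real.GammaSeq,
      Finset.prod_range_succ _ (k + 1), Nat.factorial_succ]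
    have h2 : (k : ℝ) + 1 + s = s + ((k + 1 : ℕ) : ℝ) := by push_cast; ring
    rw [h2, h1]
    push_cast
    have : (0 : ℝ) < (k : ℝ) + 1 := by positivity
    field_simp
    ring
  simp_rw [heq]
  have h1 := (Real.GammaSeq_tendsto_Gamma s).comp (tendsto_add_atTop_nat 1)
  have h2 := (tendsto_const_div_atTop_nhds_zero_nat s).comp (tendsto_add_atTop_nat 1)
  simpa [Function.comp_def] using h1.mul (h2.const_add 1)

/-- The Bergman norm with weight `β` is equivalent to the norm of `l_a^2(-(β + 1) / 2)`. -/
theorem exists_normBergman_equiv {β : ℝ} (hβ : -1 < β) :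
    ∃ c C : ℝ, 0 < c ∧ 0 < C ∧ ∀ f ∈ Hol,
      ENNReal.ofReal c * normLa2 (-(β + 1) / 2) f ≤ normBergman β f ∧
        normBergman β f ≤ ENNReal.ofReal C * normLa2 (-(β + 1) / 2) f := by
  have hs : 0 < β + 1 := by linarith
  set q : ℕ → ℝ := fun k ↦ ProbabilityTheory.beta (k + 1) (β + 1) * ((k : ℝ) + 1) ^ (β + 1) with hq
  have hq0 : ∀ k, 0 < q k := fun k ↦
    mul_pos (ProbabilityTheory.beta_pos (by positivity) hs) (by positivity)
  have hlim := tendsto_beta_mul_rpow hs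
  obtain ⟨C, hC⟩ := hlim.bddAbove_range
  obtain ⟨c, hc⟩ := (hlim.inv₀ (Real.Gamma_pos_of_pos hs).ne').bddAbove_range
  have hC' : ∀ k, q k ≤ C := fun k ↦ hC ⟨k, rfl⟩
  have hc' : ∀ k, (q k)⁻¹ ≤ c := fun k ↦ hc ⟨k, rfl⟩
  have hC0 : 0 < C := (hq0 0).trans_le (hC' 0)
  have hc0 : 0 < c := (inv_pos.mpr (hq0 0)).trans_le (hc' 0)
  have hexp : 2 * (-(β + 1) / 2) = -(β + 1) := by ring
  have hw : ∀ k : ℕ, ProbabilityTheory.beta (k + 1) (β + 1) =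
      q k * ((k : ℝ) + 1) ^ (2 * (-(β + 1) / 2)) := by
    intro k
    rw [hq, hexp, mul_assoc, ← Real.rpow_add (by positivity)]
    simp
  have hmul : ∀ (x : ℝ) (f : ℂ → ℂ), 0 ≤ x → ENNReal.ofReal (√x) * normLa2 (-(β + 1) / 2) f =
      (∑' k : ℕ, ‖taylorCoeff f k‖ₑ ^ 2 *
        ENNReal.ofReal (x * ((k : ℝ) + 1) ^ (2 * (-(β + 1) / 2)))) ^ (1 / 2 : ℝ) := by
    intro x f hx
    rw [normLa2, Real.sqrt_eq_rpow, ← ENNReal.ofReal_rpow_of_nonneg hx (by norm_num),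
      ← ENNReal.mul_rpow_of_nonneg _ _ (by norm_num), ← ENNReal.tsum_mul_left]
    congr 2
    ext k
    rw [ENNReal.ofReal_mul hx]
    ring
  refine ⟨√c⁻¹, √C, Real.sqrt_pos.mpr (inv_pos.mpr hc0), Real.sqrt_pos.mpr hC0, fun f hf ↦ ?_⟩
  rw [normBergman_eq hβ hf, hmul _ _ (inv_pos.mpr hc0).le, hmul _ _ hC0.le]
  simp_rw [hw]
  constructor
  · gcongr with k
    exact inv_le_of_inv_le₀ (hq0 k) (hc' k)
  · gcongr with k
    exact hC' k

/-! ### The interpolation constants -/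

lemma interpConst_le_maxInterpConst {n : ℕ} {r : ℝ} {lam : ℂ} (hlam : ‖lam‖ ≤ r)
    (NX NY : (ℂ → ℂ) → ℝ≥0∞) :
    interpConst (onePoint n lam) NX NY ≤ maxInterpConst n r NX NY := by
  refine le_iSup₂_of_le (f := fun σ _ ↦ interpConst σ NX NY) (onePoint n lam) ⟨?_, ?_⟩ le_rfl
  · simp [onePoint]
  · intro z hz
    rw [onePoint, Multiset.mem_replicate] at hz
    rwa [hz.2]

lemma norm_le_toReal_normHInf {g : ℂ → ℂ} (hg : normHInf g < ∞) {z : ℂ}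
    (hz : z ∈ ball (0 : ℂ) 1) : ‖g z‖ ≤ (normHInf g).toReal := by
  have h : ‖g z‖ₑ ≤ normHInf g := le_iSup₂_of_le (f := fun z _ ↦ ‖g z‖ₑ) z hz le_rfl
  simpa using ENNReal.toReal_mono hg.ne h

/-- The constant in the upper bound for `l_a^2(α)`. -/
noncomputable def upperConst (α : ℝ) : ℝ :=
  √(2 * (-4 * α) ^ (-2 * α) * 4 ^ (-2 * α) * ((1 + Real.exp 3) ^ 2 * 2))

lemma upperConst_pos {α : ℝ} (hα : α ≤ 0) : 0 < upperConst α := by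
  have h : 0 < (-4 * α) ^ (-2 * α) := by
    rcases hα.eq_or_lt with rfl | hα
    · simp
    · exact Real.rpow_pos_of_pos (by linarith) _
  exact Real.sqrt_pos.mpr (by positivity)

/-- The constant in the lower bound for `l_a^2(α)`. -/
noncomputable def lowerConst (α : ℝ) : ℝ :=
  √(((2 * (2 - 2 * α)) ^ (1 - 2 * α) * (2 - 2 * α))⁻¹)

lemma lowerConst_pos {α : ℝ} (hα : α ≤ 0) : 0 < lowerConst α := by
  have : 0 < 2 - 2 * α := by linarith
  exact Real.sqrt_pos.mpr (by positivity)

theorem maxInterpConst_le {α : ℝ} (hα : α ≤ 0) {NX : (ℂ → ℂ) → ℝ≥0∞} {c : ℝ} (hc : 0 < c)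
    (hN : ∀ f ∈ Hol, ENNReal.ofReal c * normLa2 α f ≤ NX f) {n : ℕ} (hn : 1 ≤ n) {r : ℝ}
    (hr : 0 ≤ r) (hr1 : r < 1) :
    maxInterpConst n r NX normHInf ≤
      ENNReal.ofReal (c⁻¹ * upperConst α * ((n : ℝ) / (1 - r)) ^ ((1 - 2 * α) / 2)) := by
  refine iSup₂_le fun σ hσ ↦ iSup₂_le fun f hf ↦ ?_
  obtain ⟨⟨hfH, -⟩, hf1⟩ := hf
  have hfN : normLa2 α f ≤ ENNReal.ofReal c⁻¹ := by
    rw [ENNReal.ofReal_inv_of_pos hc, ENNReal.le_inv_iff_mul_le, mul_comm]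
    exact (hN f hfH).trans hf1
  obtain ⟨g, hg, hgf, hbound⟩ := exists_interpolant hα hn hr hr1 hσ.1 hσ.2 hfH
    (hfN.trans_lt ENNReal.ofReal_lt_top)
  have hn0 : (0 : ℝ) < n := by exact_mod_cast hn
  have h1r : 0 < 1 - r := sub_pos.mpr hr1
  set y : ℝ := n / (1 - r) with hy
  have hy0 : 0 < y := by positivity
  have hsqrt : √(2 * (-4 * α) ^ (-2 * α) * ((1 - r) / (4 * n)) ^ (2 * α) *
      ((1 + Real.exp 3) ^ 2 * (2 * n / (1 - r)))) = upperConst α * y ^ ((1 - 2 * α) / 2) := by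
    have h1 : ((1 - r) / (4 * n)) ^ (2 * α) = 4 ^ (-2 * α) * y ^ (-2 * α) := by
      have : (1 - r) / (4 * n) = (4 * y)⁻¹ := by rw [hy]; field_simp
      rw [this, Real.inv_rpow (by positivity), ← Real.rpow_neg (by positivity),
        Real.mul_rpow (by norm_num) hy0.le]
      ring_nf
    have h2 : y ^ (-2 * α) * y = (y ^ ((1 - 2 * α) / 2)) ^ 2 := by
      rw [← Real.rpow_natCast (y ^ _), ← Real.rpow_mul hy0.le]
      nth_rewrite 2 [← Real.rpow_one y]
      rw [← Real.rpow_add hy0]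
      congr 1
      push_cast
      ring
    have h3 : 2 * (-4 * α) ^ (-2 * α) * ((1 - r) / (4 * n)) ^ (2 * α) *
        ((1 + Real.exp 3) ^ 2 * (2 * n / (1 - r))) =
        (2 * (-4 * α) ^ (-2 * α) * 4 ^ (-2 * α) * ((1 + Real.exp 3) ^ 2 * 2)) *
          (y ^ ((1 - 2 * α) / 2)) ^ 2 := by
      rw [h1, ← h2, hy]
      ring
    rw [h3, Real.sqrt_mul' _ (by positivity), Real.sqrt_sq (by positivity), upperConst]
  have hgN : normHInf g ≤
      ENNReal.ofReal (c⁻¹ * upperConst α * y ^ ((1 - 2 * α) / 2)) := by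
    refine iSup₂_le fun z hz ↦ ?_
    rw [← ofReal_norm]
    refine ENNReal.ofReal_le_ofReal ((hbound z hz).trans ?_)
    rw [hsqrt, mul_assoc]
    have := (upperConst_pos hα).le
    gcongr
    exact ENNReal.toReal_le_of_le_ofReal (by positivity) hfN
  exact iInf₂_le_of_le g ⟨⟨hg, hgN.trans_lt ENNReal.ofReal_lt_top⟩, hgf⟩ hgN

theorem le_interpConst {α : ℝ} (hα : α ≤ 0) {NX : (ℂ → ℂ) → ℝ≥0∞} {C : ℝ} (hC : 0 < C)
    (hN : ∀ f ∈ Hol, NX f ≤ ENNReal.ofReal C * normLa2 α f)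
    (hαN : ∃ N : ℕ, 1 - 2 * α = (N : ℝ)) {n : ℕ} (hn : 1 ≤ n) {lam : ℂ} (hlam : ‖lam‖ < 1) :
    ENNReal.ofReal (C⁻¹ * lowerConst α * ((n : ℝ) / (1 - ‖lam‖)) ^ ((1 - 2 * α) / 2)) ≤
      interpConst (onePoint n lam) NX normHInf := by
  obtain ⟨N, hαN⟩ := hαN
  obtain ⟨m, rfl⟩ : ∃ m, N = m + 1 := by
    refine Nat.exists_eq_succ_of_ne_zero ?_
    rintro rfl
    rw [Nat.cast_zero] at hαN
    linarith
  obtain ⟨f, hfH, hfN, hf⟩ := exists_extremal hαN hn hlam (inv_pos.mpr hC).le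
  have hf1 : NX f ≤ 1 := by
    calc NX f ≤ ENNReal.ofReal C * ENNReal.ofReal C⁻¹ := (hN f hfH).trans (by gcongr)
      _ = 1 := by rw [← ENNReal.ofReal_mul hC.le, mul_inv_cancel₀ hC.ne', ENNReal.ofReal_one]
  have h1a : 0 < 1 - ‖lam‖ := sub_pos.mpr hlam
  set y : ℝ := n / (1 - ‖lam‖) with hy
  have hy0 : 0 ≤ y := by positivity
  have hsqrt : √((y / (2 * (m + 2))) ^ (m + 1) / (m + 2)) =
      lowerConst α * y ^ ((1 - 2 * α) / 2) := by
    have h1 : 2 - 2 * α = m + 2 := by push_cast at hαN; linarith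
    have h2 : (y / (2 * (m + 2))) ^ (m + 1) / (m + 2) =
        ((2 * ((m : ℝ) + 2)) ^ (m + 1) * (m + 2))⁻¹ * y ^ (m + 1) := by
      rw [div_pow]
      field_simp
    rw [lowerConst, h1, hαN, Real.rpow_natCast, h2, Real.sqrt_mul (by positivity),
      Real.sqrt_eq_rpow (y ^ _), ← Real.rpow_natCast y, ← Real.rpow_mul hy0, mul_one_div]
  refine le_iSup₂_of_le f ⟨⟨hfH, hf1.trans_lt ENNReal.one_lt_top⟩, hf1⟩ (le_iInf₂ fun g hg ↦ ?_)
  obtain ⟨⟨hgH, hgN⟩, hgf⟩ := hg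
  have h := hf g hgH hgf _ fun z hz ↦ norm_le_toReal_normHInf hgN hz
  rw [hsqrt, ← mul_assoc] at h
  exact ENNReal.ofReal_le_of_le_toReal h

end DiscInterp

theorem theoremB :
    (∀ α : ℝ, α ≤ 0 → ∃ A B : ℝ, 0 < A ∧ 0 < B ∧
      ∀ (n : ℕ) (r : ℝ) (lam : ℂ), 1 ≤ n → 0 ≤ r → r < 1 → ‖lam‖ ≤ r →
        ((∃ N : ℕ, 1 - 2 * α = (N : ℝ)) →
          ENNReal.ofReal (B * ((n : ℝ) / (1 - ‖lam‖)) ^ ((1 - 2 * α) / 2)) ≤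
            DiscInterp.interpConst (DiscInterp.onePoint n lam)
              (DiscInterp.normLa2 α) DiscInterp.normHInf) ∧
        DiscInterp.interpConst (DiscInterp.onePoint n lam)
            (DiscInterp.normLa2 α) DiscInterp.normHInf ≤
          DiscInterp.maxInterpConst n r (DiscInterp.normLa2 α) DiscInterp.normHInf ∧
        DiscInterp.maxInterpConst n r (DiscInterp.normLa2 α) DiscInterp.normHInf ≤
          ENNReal.ofReal (A * ((n : ℝ) / (1 - r)) ^ ((1 - 2 * α) / 2))) ∧
    (∀ β : ℝ, -1 < β → ∃ A' B' : ℝ, 0 < A' ∧ 0 < B' ∧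
      ∀ (n : ℕ) (r : ℝ) (lam : ℂ), 1 ≤ n → 0 ≤ r → r < 1 → ‖lam‖ ≤ r →
        ((∃ N : ℕ, β + 2 = (N : ℝ)) →
          ENNReal.ofReal (B' * ((n : ℝ) / (1 - ‖lam‖)) ^ ((β + 2) / 2)) ≤
            DiscInterp.interpConst (DiscInterp.onePoint n lam)
              (DiscInterp.normBergman β) DiscInterp.normHInf) ∧
        DiscInterp.interpConst (DiscInterp.onePoint n lam)
            (DiscInterp.normBergman β) DiscInterp.normHInf ≤
          DiscInterp.maxInterpConst n r (DiscInterp.normBergman β) DiscInterp.normHInf ∧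
        DiscInterp.maxInterpConst n r (DiscInterp.normBergman β) DiscInterp.normHInf ≤
          ENNReal.ofReal (A' * ((n : ℝ) / (1 - r)) ^ ((β + 2) / 2))) := by
  refine ⟨fun α hα ↦ ?_, fun β hβ ↦ ?_⟩
  · have hN : ∀ f ∈ DiscInterp.Hol,
        ENNReal.ofReal 1 * DiscInterp.normLa2 α f = DiscInterp.normLa2 α f := fun f _ ↦ by simp
    have hA := DiscInterp.upperConst_pos hα
    have hB := DiscInterp.lowerConst_pos hα
    refine ⟨1⁻¹ * DiscInterp.upperConst α, 1⁻¹ * DiscInterp.lowerConst α, by positivity,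
      by positivity, fun n r lam hn hr hr1 hlam ↦ ⟨fun h ↦ ?_,
        DiscInterp.interpConst_le_maxInterpConst hlam _ _, ?_⟩⟩
    · exact DiscInterp.le_interpConst hα one_pos (fun f hf ↦ (hN f hf).ge) h hn
        (hlam.trans_lt hr1)
    · exact DiscInterp.maxInterpConst_le hα one_pos (fun f hf ↦ (hN f hf).le) hn hr hr1
  · obtain ⟨c, C, hc, hC, hN⟩ := DiscInterp.exists_normBergman_equiv hβ
    have hα : -(β + 1) / 2 ≤ 0 := by linarith
    have hA := DiscInterp.upperConst_pos hα
    have hB := DiscInterp.lowerConst_pos hα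
    have hexp : β + 2 = 1 - 2 * (-(β + 1) / 2) := by ring
    refine ⟨c⁻¹ * DiscInterp.upperConst (-(β + 1) / 2), C⁻¹ * DiscInterp.lowerConst (-(β + 1) / 2),
      by positivity, by positivity, fun n r lam hn hr hr1 hlam ↦ ⟨fun h ↦ ?_,
        DiscInterp.interpConst_le_maxInterpConst hlam _ _, ?_⟩⟩
    · rw [hexp] at h ⊢
      exact DiscInterp.le_interpConst hα hC (fun f hf ↦ (hN f hf).2) h hn (hlam.trans_lt hr1)
    · rw [hexp]
      exact DiscInterp.maxInterpConst_le hα hc (fun f hf ↦ (hN f hf).1) hn hr hr1
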